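/- **Setting.** There are $n$ base arms; arm $e\in[n]$ has a reward distribution with mean $w(e)$ and an $R$-sub-Gaussian tail ($\mathbb E\,e^{s(X-w(e))}\le e^{R^2s^2/2}$ for all $s\in\mathbb R$), $R>0$. The decision class $\mathcal M$ is a collection of at least two nonempty subsets of $[n]$ (super arms). For $M\in\mathcal M$ and $v\in\mathbb R^n$ let $\mathtt{MinW}(M,v)=\min_{e\in M}v(e)$, and assume that $M_*=\arg\max_{M\in\mathcal M}\mathtt{MinW}(M,w)$ is unique; $\mathtt{OPT}=\mathtt{MinW}(M_*,w)$. Among the base arms that belong to some super arm but not to $M_*$, let $N$ be those with $w(e)<\mathtt{OPT}$ and $\tilde N$ those with $w(e)\ge\mathtt{OPT}$. The gap is $\Delta_e=w(e)-\max_{M\ne M_*}\mathtt{MinW}(M,w)$ for $e\in M_*$, $\Delta_e=w(e)-\max_{M\ni e}\mathtt{MinW}(M,w)$ for $e\in\tilde N$, and $\Delta_e=\mathtt{OPT}-\max_{M\ni e}\mathtt{MinW}(M,w)$ for $e\in N$. Assume the normalization $\sum_{e\in M_*\cup N\cup\tilde N}R^2/\Delta_e^2\ge n$ (which holds, for instance,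 when every base arm belongs to some super arm and all $\Delta_e\le R$). **Subroutines.** Ties in every $\arg\min$, $\arg\max$ and in the following are broken arbitrarily. $\mathtt{MaxOracle}(\mathcal F,v)$ returns an element of $\arg\max_{M\in\mathcal F}\mathtt{MinW}(M,v)$. Let $\mathcal S(M)$ be the set of supersets of $M$. $\mathtt{BottleneckSearch}(\mathcal M,M,v)$ returns a set $A\subseteq[n]$ such that every $M'\in\mathcal M\setminus\mathcal S(M)$ has some $e\in A\cap M'$ with $v(e)=\mathtt{MinW}(M',v)$, and every $e\in A$ lies in some $M'\in\mathcal M\setminus\mathcal S(M)$ with $v(e)=\mathtt{MinW}(M',v)$. **Algorithms.** A phase with confidence $\rho$ first plays every base arm once. After that, at each round $t=n+1,n+2,\dots$ ($t-1$ is the number of samples so far in the phase), with $T_t(e)$ the number of plays and $\hat w_t(e)$ the empirical mean of arm $e$ in this phase, it sets $\mathrm{rad}_t(e)=R\sqrt{2\ln(4nt^3/\rho)/T_t(e)}$, $\underline w_t=\hat w_t-\mathrm{rad}_t$, $\bar w_t=\hat w_t+\mathrm{rad}_t$. - $\mathtt{BLUCB\text{-}Explore}$ is a phase with confidence $\kappa=0.01$.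 At round $t$ let $M_t=\mathtt{MaxOracle}(\mathcal M,\underline w_t)$ and $\hat B_t=\mathtt{BottleneckSearch}(\mathcal M,M_t,\underline w_t)$. If $\bar w_t(e)\le\frac12(\mathtt{MinW}(M_t,\underline w_t)+\underline w_t(e))$ for all $e\in\hat B_t$, return $(M_t,\hat B_t)$. Otherwise play the arm with the largest $\mathrm{rad}_t$ among $c_t=\arg\min_{e\in M_t}\underline w_t(e)$ and the $e\in\hat B_t$ that violate this inequality. - $\mathtt{BLUCB\text{-}Verify}$ with confidence $\delta^V$ runs $\mathtt{BLUCB\text{-}Explore}$, obtaining $(\hat M_*,\hat B)$, and then, with fresh statistics, a phase with confidence $\delta^V$. At round $t$, if $\mathtt{MinW}(\hat M_*,\underline w_t)\ge\max_{M\in\mathcal M\setminus\mathcal S(\hat M_*)}\mathtt{MinW}(M,\bar w_t)$ (trivially true if $\mathcal M\setminus\mathcal S(\hat M_*)=\emptyset$), return $\hat M_*$. Otherwise play the arm with the largest $\mathrm{rad}_t$ among $c_t=\arg\min_{e\in\hat M_*}\underline w_t(e)$ and the $e\in\hat B$ with $\bar w_t(e)>\underline w_t(c_t)$. - $\mathtt{BLUCB\text{-}Parallel}$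 with confidence $\delta$: let $\mathtt{BLUCB\text{-}Verify}_k$ ($k=0,1,\dots$) be copies of $\mathtt{BLUCB\text{-}Verify}$ with confidences $\delta/2^{k+1}$. For $t=1,2,\dots$, for each $k=0,1,\dots$ with $2^k\mid t$, advance $\mathtt{BLUCB\text{-}Verify}_k$ by one sample; as soon as a copy returns an answer, return that answer. All samples are independent. **Theorem.** There is an absolute constant $C>0$ such that for every such instance and every $0<\delta<0.01$, $\mathtt{BLUCB\text{-}Parallel}$ terminates and returns $M_*$ with probability at least $1-\delta$, and the expectation of the total number of samples that it takes is at most $$C\Bigg(\sum_{e\in M_*\cup N}\frac{R^2}{\Delta_e^2}\,\ln\Bigg(\frac1\delta\sum_{e\in M_*\cup N}\frac{R^2n}{\Delta_e^2}\Bigg)+\sum_{e\in\tilde N}\frac{R^2}{\Delta_e^2}\,\ln\Bigg(\sum_{e\in\tilde N}\frac{R^2n}{\Delta_e^2}\Bigg)\Bigg),$$ where a sum over the empty set is $0$ and $0\ln 0=0$. -/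

import Mathlib

open MeasureTheory ProbabilityTheory
open scoped NNReal ENNReal

namespace CPEB

/-! ### The bottleneck problem

Base arms are the elements of `Fin n`, a super arm is a finite set of base arms, and a decision
class is a finite set of super arms. -/

/-- The bottleneck value `MinW(M, v) = min_{e ∈ M} v e` of a nonempty super arm. -/
noncomputable def minW {n : ℕ} (M : Finset (Fin n)) (v : Fin n → ℝ) : ℝ :=
  if h : M.Nonempty then M.inf' h v else 0

/-- The largest bottleneck value `max_{M ∈ F} MinW(M, v)` in a nonempty class `F`. -/
noncomputable def maxMinW {n : ℕ} (F : Finset (Finset (Fin n))) (v : Fin n → ℝ) : ℝ :=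
  if h : F.Nonempty then F.sup' h (fun M => minW M v) else 0

/-- `F \ S(M)`: the members of `F` that are not supersets of `M`. -/
def nonSupersets {n : ℕ} (F : Finset (Finset (Fin n))) (M : Finset (Fin n)) :
    Finset (Finset (Fin n)) :=
  F.filter (fun M' => ¬ M ⊆ M')

/-- `M` is the unique optimal super arm of `F` for the mean vector `w`. -/
def IsUniqueOptimal {n : ℕ} (F : Finset (Finset (Fin n))) (w : Fin n → ℝ)
    (M : Finset (Fin n)) : Prop :=
  M ∈ F ∧ ∀ M' ∈ F, M' ≠ M → minW M' w < minW M w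

/-- The necessary base arms `N`: contained in some super arm, not contained in the optimal super
arm `Ms`, and with mean below the optimal value. -/
noncomputable def necessaryArms {n : ℕ} (F : Finset (Finset (Fin n))) (w : Fin n → ℝ)
    (Ms : Finset (Fin n)) : Finset (Fin n) :=
  Finset.univ.filter (fun e => (∃ M ∈ F, e ∈ M) ∧ e ∉ Ms ∧ w e < minW Ms w)

/-- The unnecessary base arms `Ñ`: contained in some super arm, not contained in the optimal super
arm `Ms`, and with mean at least the optimal value. -/
noncomputable def unnecessaryArms {n : ℕ} (F : Finset (Finset (Fin n))) (w : Fin n → ℝ)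
    (Ms : Finset (Fin n)) : Finset (Fin n) :=
  Finset.univ.filter (fun e => (∃ M ∈ F, e ∈ M) ∧ e ∉ Ms ∧ minW Ms w ≤ w e)

/-- The fixed-confidence gap of a base arm. -/
noncomputable def gap {n : ℕ} (F : Finset (Finset (Fin n))) (w : Fin n → ℝ)
    (Ms : Finset (Fin n)) (e : Fin n) : ℝ :=
  if e ∈ Ms then w e - maxMinW (F.erase Ms) w
  else if minW Ms w ≤ w e then w e - maxMinW (F.filter (fun M => e ∈ M)) w
  else minW Ms w - maxMinW (F.filter (fun M => e ∈ M)) w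

/-- The hardness `∑_{e ∈ A} R² / Δ_e²` of a set `A` of base arms. -/
noncomputable def hardness {n : ℕ} (F : Finset (Finset (Fin n))) (w : Fin n → ℝ)
    (Ms : Finset (Fin n)) (R : ℝ≥0) (A : Finset (Fin n)) : ℝ :=
  ∑ e ∈ A, (R : ℝ) ^ 2 / gap F w Ms e ^ 2

/-! ### The offline subroutines -/

/-- The offline subroutines that the algorithms call, with arbitrary tie-breaking: a bottleneck
maximization oracle, a bottleneck search, and the selection of an `argmin` and an `argmax` over a
nonempty set of base arms. -/
structure Subroutines {n : ℕ} (F : Finset (Finset (Fin n))) where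
  /-- `MaxOracle(G, v)` for a nonempty class `G ⊆ F`. -/
  maxOracle : Finset (Finset (Fin n)) → (Fin n → ℝ) → Finset (Fin n)
  maxOracle_mem : ∀ (G : Finset (Finset (Fin n))) (v : Fin n → ℝ), G ⊆ F → G.Nonempty →
    maxOracle G v ∈ G
  maxOracle_max : ∀ (G : Finset (Finset (Fin n))) (v : Fin n → ℝ), G ⊆ F → G.Nonempty →
    ∀ M ∈ G, minW M v ≤ minW (maxOracle G v) v
  /-- `BottleneckSearch(F, M, v)` for a super arm `M ∈ F`. -/
  bottleneckSearch : Finset (Fin n) → (Fin n → ℝ) → Finset (Fin n)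
  bottleneckSearch_complete : ∀ M ∈ F, ∀ v : Fin n → ℝ, ∀ M' ∈ nonSupersets F M,
    ∃ e ∈ bottleneckSearch M v, e ∈ M' ∧ v e = minW M' v
  bottleneckSearch_sound : ∀ M ∈ F, ∀ v : Fin n → ℝ, ∀ e ∈ bottleneckSearch M v,
    ∃ M' ∈ nonSupersets F M, e ∈ M' ∧ v e = minW M' v
  argmin : Finset (Fin n) → (Fin n → ℝ) → Fin n
  argmin_mem : ∀ (A : Finset (Fin n)) (v : Fin n → ℝ), A.Nonempty → argmin A v ∈ A
  argmin_le : ∀ (A : Finset (Fin n)) (v : Fin n → ℝ), A.Nonempty → ∀ e ∈ A, v (argmin A v) ≤ v e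
  argmax : Finset (Fin n) → (Fin n → ℝ) → Fin n
  argmax_mem : ∀ (A : Finset (Fin n)) (v : Fin n → ℝ), A.Nonempty → argmax A v ∈ A
  le_argmax : ∀ (A : Finset (Fin n)) (v : Fin n → ℝ), A.Nonempty → ∀ e ∈ A, v e ≤ v (argmax A v)

/-! ### Statistics of a phase

Each of the two phases (exploration, verification) of each run keeps its own statistics. A phase
reads its rewards from a table `x`: `x e i` is the reward of the `(i+1)`-th play of base arm `e` in
that phase. So the vector `T` of the numbers of plays determines all the observations so far. -/

/-- The empirical mean of base arm `e` after `T e` plays. -/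
noncomputable def empMean {n : ℕ} (x : Fin n → ℕ → ℝ) (T : Fin n → ℕ) (e : Fin n) : ℝ :=
  (∑ i ∈ Finset.range (T e), x e i) / (T e : ℝ)

/-- The index `t` of the current timestep of the phase: one more than the number of samples. -/
def timestep {n : ℕ} (T : Fin n → ℕ) : ℕ := (∑ e, T e) + 1

/-- The confidence radius `R √(2 ln(4 n t³ / δ) / T e)`. -/
noncomputable def rad {n : ℕ} (R : ℝ≥0) (δ : ℝ) (T : Fin n → ℕ) (e : Fin n) : ℝ :=
  (R : ℝ) * Real.sqrt (2 * Real.log (4 * (n : ℝ) * (timestep T : ℝ) ^ 3 / δ) / (T e : ℝ))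

/-- The lower confidence bound. -/
noncomputable def lcb {n : ℕ} (R : ℝ≥0) (δ : ℝ) (x : Fin n → ℕ → ℝ) (T : Fin n → ℕ)
    (e : Fin n) : ℝ :=
  empMean x T e - rad R δ T e

/-- The upper confidence bound. -/
noncomputable def ucb {n : ℕ} (R : ℝ≥0) (δ : ℝ) (x : Fin n → ℕ → ℝ) (T : Fin n → ℕ)
    (e : Fin n) : ℝ :=
  empMean x T e + rad R δ T e

/-! ### The algorithms -/

/-- What a phase does next: play a base arm, or stop with an output. -/
inductive Decision (n : ℕ) (α : Type) : Type where
  | play (e : Fin n) : Decision n α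
  | halt (a : α) : Decision n α

/-- The base arms that the initialization (every base arm once) has not played yet. -/
def unplayed {n : ℕ} (T : Fin n → ℕ) : Finset (Fin n) :=
  Finset.univ.filter (fun e => T e = 0)

/-- `BLUCB-Explore` with confidence `κ`: its output is a super arm and a set of base arms. -/
noncomputable def exploreDecision {n : ℕ} {F : Finset (Finset (Fin n))} (O : Subroutines F)
    (R : ℝ≥0) (κ : ℝ) (x : Fin n → ℕ → ℝ) (T : Fin n → ℕ) :
    Decision n (Finset (Fin n) × Finset (Fin n)) :=
  if h : (unplayed T).Nonempty then .play ((unplayed T).min' h)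
  else
    let lo := lcb R κ x T
    let up := ucb R κ x T
    let M := O.maxOracle F lo
    let B := O.bottleneckSearch M lo
    if ∀ e ∈ B, up e ≤ (1 / 2) * (minW M lo + lo e) then .halt (M, B)
    else
      let c := O.argmin M lo
      let B' := B.filter (fun e => (1 / 2) * (minW M lo + lo e) < up e)
      .play (O.argmax (B' ∪ {c}) (rad R κ T))

/-- The verification part of `BLUCB-Verify` with confidence `δV`, for the super arm `Mhat` and the
set `Bhat` obtained from the exploration. The stopping condition compares `Mhat` with the best
member of `F \ S(Mhat)`; it holds trivially if that class is empty. -/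
noncomputable def verifyDecision {n : ℕ} {F : Finset (Finset (Fin n))} (O : Subroutines F)
    (R : ℝ≥0) (δV : ℝ) (Mhat Bhat : Finset (Fin n)) (x : Fin n → ℕ → ℝ) (T : Fin n → ℕ) :
    Decision n (Finset (Fin n)) :=
  if h : (unplayed T).Nonempty then .play ((unplayed T).min' h)
  else
    let lo := lcb R δV x T
    let up := ucb R δV x T
    let G := nonSupersets F Mhat
    if G = ∅ ∨ minW (O.maxOracle G up) up ≤ minW Mhat lo then .halt Mhat
    else
      let c := O.argmin Mhat lo
      let Ft := Bhat.filter (fun e => lo c < up e)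
      .play (O.argmax (Ft ∪ {c}) (rad R δV T))

/-- The state of `BLUCB-Verify` between two samples. -/
inductive VerifyState (n : ℕ) : Type where
  /-- running `BLUCB-Explore` -/
  | exploring (T : Fin n → ℕ) : VerifyState n
  /-- running the verification part -/
  | verifying (Mhat Bhat : Finset (Fin n)) (T : Fin n → ℕ) : VerifyState n
  /-- having returned an answer -/
  | returned (M : Finset (Fin n)) : VerifyState n

/-- The answer of `BLUCB-Verify`, if it has returned one. -/
def VerifyState.answer {n : ℕ} : VerifyState n → Option (Finset (Fin n))
  | .exploring _ => none
  | .verifying _ _ _ => none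
  | .returned M => some M

/-- The exploration confidence `κ = 0.01`. -/
noncomputable def kappa : ℝ := 1 / 100

/-- `BLUCB-Verify` takes one sample. Here `xE` and `xV` are the reward tables of its exploration and
of its verification phase. -/
noncomputable def VerifyState.sample {n : ℕ} {F : Finset (Finset (Fin n))} (O : Subroutines F)
    (R : ℝ≥0) (δV : ℝ) (xE xV : Fin n → ℕ → ℝ) : VerifyState n → VerifyState n
  | .exploring T =>
    match exploreDecision O R kappa xE T with
    | .play e => .exploring (T + Pi.single e 1)
    | .halt _ => .exploring T
  | .verifying Mhat Bhat T =>
    match verifyDecision O R δV Mhat Bhat xV T with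
    | .play e => .verifying Mhat Bhat (T + Pi.single e 1)
    | .halt _ => .verifying Mhat Bhat T
  | .returned M => .returned M

/-- `BLUCB-Verify` evaluates the stopping condition of its current phase after a sample: if it holds,
the exploration hands over to the verification with fresh statistics, and the verification returns
its answer. -/
noncomputable def VerifyState.check {n : ℕ} {F : Finset (Finset (Fin n))} (O : Subroutines F)
    (R : ℝ≥0) (δV : ℝ) (xE xV : Fin n → ℕ → ℝ) : VerifyState n → VerifyState n
  | .exploring T =>
    match exploreDecision O R kappa xE T with
    | .play _ => .exploring T
    | .halt (M, B) => .verifying M B 0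
  | .verifying Mhat Bhat T =>
    match verifyDecision O R δV Mhat Bhat xV T with
    | .play _ => .verifying Mhat Bhat T
    | .halt M => .returned M
  | .returned M => .returned M

/-- The two phases of a run of `BLUCB-Verify`. -/
inductive Phase : Type where
  | explore : Phase
  | verify : Phase

/-- The state of `BLUCB-Parallel`: the states of the sub-algorithms `BLUCB-Verify_k`, the total
number of samples taken so far by all of them, and the answer, if one has been returned. -/
structure ParallelState (n : ℕ) : Type where
  sub : ℕ → VerifyState n
  samples : ℕ
  out : Option (Finset (Fin n))

/-- The confidence `δ_k = δ / 2^(k+1)` of the `k`-th sub-algorithm. -/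
noncomputable def confidence (δ : ℝ) (k : ℕ) : ℝ := δ / 2 ^ (k + 1)

/-- Start or resume `BLUCB-Verify_k` with one sample and then suspend it; if it returns an answer,
`BLUCB-Parallel` returns that answer. Nothing happens once `BLUCB-Parallel` has returned.
Here `x k ph e i` is the reward of the `(i+1)`-th play of base arm `e` in phase `ph` of
`BLUCB-Verify_k`. -/
noncomputable def ParallelState.resume {n : ℕ} {F : Finset (Finset (Fin n))} (O : Subroutines F)
    (R : ℝ≥0) (δ : ℝ) (x : ℕ → Phase → Fin n → ℕ → ℝ) (s : ParallelState n) (k : ℕ) :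
    ParallelState n :=
  match s.out with
  | some _ => s
  | none =>
    let δk := confidence δ k
    let v := ((s.sub k).sample O R δk (x k .explore) (x k .verify)).check O R δk
      (x k .explore) (x k .verify)
    { sub := Function.update s.sub k v
      samples := s.samples + 1
      out := v.answer }

/-- The state of `BLUCB-Parallel` after timestep `t`. In timestep `t` the sub-algorithms with
`2^k ∣ t` are resumed in increasing order of `k` (all these `k` are smaller than `t`). -/
noncomputable def parallel {n : ℕ} {F : Finset (Finset (Fin n))} (O : Subroutines F)
    (R : ℝ≥0) (δ : ℝ) (x : ℕ → Phase → Fin n → ℕ → ℝ) : ℕ → ParallelState n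
  | 0 => { sub := fun _ => .exploring 0, samples := 0, out := none }
  | t + 1 =>
    ((List.range (t + 1)).filter (fun k => 2 ^ k ∣ t + 1)).foldl
      (ParallelState.resume O R δ x) (parallel O R δ x t)

/-- `BLUCB-Parallel` terminates and returns `M`. -/
def Returns {n : ℕ} {F : Finset (Finset (Fin n))} (O : Subroutines F) (R : ℝ≥0) (δ : ℝ)
    (x : ℕ → Phase → Fin n → ℕ → ℝ) (M : Finset (Fin n)) : Prop :=
  ∃ t, (parallel O R δ x t).out = some M

/-- The total number of samples that `BLUCB-Parallel` takes (`∞` if it does not terminate). -/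
noncomputable def sampleComplexity {n : ℕ} {F : Finset (Finset (Fin n))} (O : Subroutines F)
    (R : ℝ≥0) (δ : ℝ) (x : ℕ → Phase → Fin n → ℕ → ℝ) : ℝ≥0∞ :=
  ⨆ t, ((parallel O R δ x t).samples : ℝ≥0∞)

end CPEB

open CPEB

/-!
The proof separates a deterministic analysis from a concentration bound. Call the rewards of a
phase *accurate* if every empirical mean stays within its confidence radius (`Accurate`).

*One round.* On accurate rewards, an exploration that stops has found the optimal super arm,
together with a set of base arms that separates it from every competitor (`explore_halt_correct`).
As long as it continues after its initialization, the base arm `e` that it plays has `Δ_e ≤ 6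
rad(e)` (`explore_play_gap_le`): the key point is that the optimal value exceeds the largest lower
confidence bound of a bottleneck value by at most twice the largest radius in contention. The
verification of the optimal super arm, guided by the separating set, only plays optimal or
necessary base arms after its initialization, with `Δ_e ≤ 8 rad(e)` (`verify_play_gap_le`); so the
unnecessary base arms contribute nothing to the part of the cost that depends on `δ`. The
verification of any super arm never returns a wrong answer (`verify_halt_correct`).

*One run.* A bound `Δ_e ≤ a rad(e)` limits the number of plays of `e` by `2 a² (R² / Δ_e²)` times
a logarithm of the time. Summing over the base arms, a phase that has taken `m` samples satisfies
`m ≤ n + H ln(4 n m³ / δ)`, so it ends before any `m` that violates this (`verifyRun_eq_returned`,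
`exists_phase_length`).

*Parallel composition.* If the `k`-th run returns after `j` samples, `BLUCB-Parallel` stops after
at most `2 ^ k * j` timesteps and twice as many samples (`sampleComplexity_le`). Each run fails to
have accurate rewards with probability at most `1 / 8`, independently of the others, so that the
first `k` runs all fail with probability at most `8 ^ (-k)` (`measure_failures_le`), while the
`k`-th run costs `O(2 ^ k (k + 1))` times the claimed bound; the expected cost is a convergent
geometric series (`lintegral_le_tsum_prefix`). For the correctness, almost surely some run has
accurate rewards and returns, and an answer can be wrong only if the verification rewards of some
run are not accurate, which has probability at most `∑ δ / 2 ^ (k + 1) = δ`.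

The subroutines need not be measurable functions of the rewards. Therefore all events are
controlled through `Accurate`, which is measurable and does not mention the algorithm.
-/

namespace CPEB

/-! ### Bottleneck values and gaps -/

section Bottleneck

variable {n : ℕ} {F G : Finset (Finset (Fin n))} {M M' Ms : Finset (Fin n)}
  {u v w : Fin n → ℝ} {e : Fin n}

lemma minW_le (v : Fin n → ℝ) (he : e ∈ M) : minW M v ≤ v e := by
  have hM : M.Nonempty := ⟨e, he⟩
  rw [minW, dif_pos hM]
  exact Finset.inf'_le _ he

lemma exists_eq_minW (hM : M.Nonempty) (v : Fin n → ℝ) : ∃ e ∈ M, v e = minW M v := by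
  obtain ⟨e, he, h⟩ := Finset.exists_mem_eq_inf' hM v
  exact ⟨e, he, by rw [minW, dif_pos hM, h]⟩

lemma minW_mono (hM : M.Nonempty) (h : ∀ e ∈ M, u e ≤ v e) : minW M u ≤ minW M v := by
  obtain ⟨e, he, hv⟩ := exists_eq_minW hM v
  exact hv ▸ (minW_le u he).trans (h e he)

lemma minW_anti (hM : M.Nonempty) (h : M ⊆ M') (v : Fin n → ℝ) : minW M' v ≤ minW M v := by
  obtain ⟨e, he, hv⟩ := exists_eq_minW hM v
  exact hv ▸ minW_le v (h he)

lemma minW_le_maxMinW (hM : M ∈ G) (v : Fin n → ℝ) : minW M v ≤ maxMinW G v := by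
  have hG : G.Nonempty := ⟨M, hM⟩
  rw [maxMinW, dif_pos hG]
  exact Finset.le_sup' (fun M => minW M v) hM

lemma exists_eq_maxMinW (hG : G.Nonempty) (v : Fin n → ℝ) : ∃ M ∈ G, maxMinW G v = minW M v := by
  obtain ⟨M, hM, h⟩ := Finset.exists_mem_eq_sup' hG (fun M => minW M v)
  exact ⟨M, hM, by rw [maxMinW, dif_pos hG, h]⟩

lemma mem_nonSupersets : M' ∈ nonSupersets F M ↔ M' ∈ F ∧ ¬ M ⊆ M' := by
  simp [nonSupersets]

lemma IsUniqueOptimal.eq_of_le (h : IsUniqueOptimal F w Ms) (hM : M ∈ F)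
    (hle : minW Ms w ≤ minW M w) : M = Ms := by
  by_contra hne
  exact absurd (h.2 M hM hne) (not_lt.2 hle)

/-- A subset of the optimal super arm is at least as good, since its minimum is over fewer base
arms. -/
lemma IsUniqueOptimal.eq_of_subset (h : IsUniqueOptimal F w Ms) (hM : M ∈ F) (hM0 : M.Nonempty)
    (hsub : M ⊆ Ms) : M = Ms :=
  h.eq_of_le hM (minW_anti hM0 hsub w)

/-- The base arms that occur in some super arm, sorted into optimal, necessary and unnecessary
ones. -/
noncomputable def relevantArms (F : Finset (Finset (Fin n))) (w : Fin n → ℝ)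
    (Ms : Finset (Fin n)) : Finset (Fin n) :=
  Ms ∪ necessaryArms F w Ms ∪ unnecessaryArms F w Ms

lemma mem_relevantArms (hM : M ∈ F) (he : e ∈ M) : e ∈ relevantArms F w Ms := by
  simp only [relevantArms, necessaryArms, unnecessaryArms, Finset.mem_union, Finset.mem_filter,
    Finset.mem_univ, true_and]
  have : ∃ M ∈ F, e ∈ M := ⟨M, hM, he⟩
  by_cases heMs : e ∈ Ms
  · exact .inl (.inl heMs)
  · rcases lt_or_ge (w e) (minW Ms w) with h | h
    · exact .inl (.inr ⟨this, heMs, h⟩)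
    · exact .inr ⟨this, heMs, h⟩

lemma mem_union_necessaryArms (hM : M ∈ F) (he : e ∈ M) (h : w e < minW Ms w) :
    e ∈ Ms ∪ necessaryArms F w Ms := by
  simp only [necessaryArms, Finset.mem_union, Finset.mem_filter, Finset.mem_univ, true_and]
  have : ∃ M ∈ F, e ∈ M := ⟨M, hM, he⟩
  tauto

lemma gap_le_of_mem (he : e ∈ Ms) (hM : M ∈ F) (hne : M ≠ Ms) :
    gap F w Ms e ≤ w e - minW M w := by
  rw [gap, if_pos he]
  linarith [minW_le_maxMinW (Finset.mem_erase.2 ⟨hne, hM⟩) w]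

lemma gap_le_of_le (he : e ∉ Ms) (hw : minW Ms w ≤ w e) (hM : M ∈ F) (heM : e ∈ M) :
    gap F w Ms e ≤ w e - minW M w := by
  rw [gap, if_neg he, if_pos hw]
  have hmem : M ∈ F.filter (fun M => e ∈ M) := Finset.mem_filter.2 ⟨hM, heM⟩
  linarith [minW_le_maxMinW hmem w]

lemma gap_le_of_lt (he : e ∉ Ms) (hw : w e < minW Ms w) (hM : M ∈ F) (heM : e ∈ M) :
    gap F w Ms e ≤ minW Ms w - minW M w := by
  rw [gap, if_neg he, if_neg (not_le.2 hw)]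
  have hmem : M ∈ F.filter (fun M => e ∈ M) := Finset.mem_filter.2 ⟨hM, heM⟩
  linarith [minW_le_maxMinW hmem w]

lemma gap_pos (hcard : 2 ≤ F.card) (hMs : IsUniqueOptimal F w Ms)
    (he : e ∈ relevantArms F w Ms) : 0 < gap F w Ms e := by
  by_cases heMs : e ∈ Ms
  · have hG : (F.erase Ms).Nonempty := by
      rw [← Finset.card_pos, Finset.card_erase_of_mem hMs.1]
      omega
    obtain ⟨M, hM, h⟩ := exists_eq_maxMinW hG w
    rw [gap, if_pos heMs, h]
    have := hMs.2 M (Finset.mem_erase.1 hM).2 (Finset.mem_erase.1 hM).1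
    linarith [minW_le w heMs]
  · have hG : (F.filter (fun M => e ∈ M)).Nonempty := by
      simp only [relevantArms, necessaryArms, unnecessaryArms, Finset.mem_union,
        Finset.mem_filter, Finset.mem_univ, true_and] at he
      have : ∃ M ∈ F, e ∈ M := by tauto
      obtain ⟨M, hM, heM⟩ := this
      exact ⟨M, Finset.mem_filter.2 ⟨hM, heM⟩⟩
    obtain ⟨M, hM, h⟩ := exists_eq_maxMinW hG w
    rw [Finset.mem_filter] at hM
    have hne : M ≠ Ms := fun h => heMs (h ▸ hM.2)
    have := hMs.2 M hM.1 hne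
    rw [gap, if_neg heMs, h]
    split_ifs <;> linarith

end Bottleneck

/-! ### One round with valid confidence bounds

Throughout, `lo` is a lower confidence bound for the means `w` and `rd` the confidence radius, so
that `lo + 2 * rd` is the upper confidence bound. -/

section Round

variable {n : ℕ} {F : Finset (Finset (Fin n))} {M B Ms : Finset (Fin n)}
  {w lo up rd : Fin n → ℝ}

lemma Subroutines.apply_argmin (O : Subroutines F) (hM : M.Nonempty) (v : Fin n → ℝ) :
    v (O.argmin M v) = minW M v := by
  obtain ⟨e, he, h⟩ := exists_eq_minW hM v
  exact le_antisymm (h ▸ O.argmin_le M v hM e he) (minW_le v (O.argmin_mem M v hM))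

/-- What the exploration guarantees about the set that it hands to the verification: every
competitor of the optimal super arm has an element of the set that witnesses half of the difference
of the bottleneck values, and every element of the set is such a witness for some competitor. -/
def Separating (F : Finset (Finset (Fin n))) (w : Fin n → ℝ) (Ms B : Finset (Fin n)) : Prop :=
  (∀ M ∈ nonSupersets F Ms, ∃ e ∈ B, e ∈ M ∧ w e ≤ (minW Ms w + minW M w) / 2) ∧
    ∀ e ∈ B, ∃ M ∈ nonSupersets F Ms, e ∈ M ∧ w e ≤ (minW Ms w + minW M w) / 2

/-- If the exploration stops while its confidence bounds are valid, its output is correct. -/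
lemma explore_halt_correct (hne : ∀ M ∈ F, M.Nonempty) (hMs : IsUniqueOptimal F w Ms)
    (O : Subroutines F) (hlo : ∀ e, lo e ≤ w e) (hup : ∀ e, w e ≤ up e)
    (hhalt : ∀ e ∈ O.bottleneckSearch (O.maxOracle F lo) lo,
      up e ≤ (1 / 2) * (minW (O.maxOracle F lo) lo + lo e)) :
    O.maxOracle F lo = Ms ∧ Separating F w Ms (O.bottleneckSearch Ms lo) := by
  have hF : F.Nonempty := ⟨Ms, hMs.1⟩
  set M := O.maxOracle F lo with hMdef
  have hM : M ∈ F := O.maxOracle_mem F lo subset_rfl hF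
  have hmax := O.maxOracle_max F lo subset_rfl hF
  have hMw : minW M lo ≤ minW M w := minW_mono (hne M hM) fun e _ => hlo e
  have hMMs : M = Ms := by
    by_cases hsub : M ⊆ Ms
    · exact hMs.eq_of_subset hM (hne M hM) hsub
    · obtain ⟨e, heB, heMs, he⟩ :=
        O.bottleneckSearch_complete M hM lo Ms (mem_nonSupersets.2 ⟨hMs.1, hsub⟩)
      have h1 := hhalt e heB
      have h2 := hmax Ms hMs.1
      have h3 := minW_le w heMs
      refine hMs.eq_of_le hM ?_
      linarith [hup e]
  -- a bottleneck arm of `M'` in the set is at most midway between the two bottleneck values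
  have key : ∀ M' ∈ nonSupersets F Ms, ∀ e ∈ O.bottleneckSearch Ms lo, lo e = minW M' lo →
      w e ≤ (minW Ms w + minW M' w) / 2 := by
    intro M' hM' e heB he
    have h1 := hhalt e (hMMs.symm ▸ heB)
    have h2 : minW M' lo ≤ minW M' w :=
      minW_mono (hne M' (mem_nonSupersets.1 hM').1) fun e _ => hlo e
    rw [hMMs] at hMw h1
    linarith [hup e]
  refine ⟨hMMs, fun M' hM' => ?_, fun e heB => ?_⟩
  · obtain ⟨e, heB, heM, he⟩ := O.bottleneckSearch_complete Ms hMs.1 lo M' hM'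
    exact ⟨e, heB, heM, key M' hM' e heB he⟩
  · obtain ⟨M', hM', heM, he⟩ := O.bottleneckSearch_sound Ms hMs.1 lo e heB
    exact ⟨M', hM', heM, key M' hM' e heB he⟩

/-- If the exploration continues while its confidence bounds are valid, the gap of the base arm
that it plays is at most six times the confidence radius. -/
lemma explore_play_gap_le (hne : ∀ M ∈ F, M.Nonempty) (hMs : IsUniqueOptimal F w Ms)
    (O : Subroutines F) (hlo : ∀ e, lo e ≤ w e) (hup : ∀ e, w e ≤ up e)
    (hrd : ∀ e, up e = lo e + 2 * rd e)
    (hgo : ¬ ∀ e ∈ O.bottleneckSearch (O.maxOracle F lo) lo,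
      up e ≤ (1 / 2) * (minW (O.maxOracle F lo) lo + lo e))
    {p : Fin n}
    (hp : p = O.argmax ((O.bottleneckSearch (O.maxOracle F lo) lo).filter
      (fun e => (1 / 2) * (minW (O.maxOracle F lo) lo + lo e) < up e) ∪
        {O.argmin (O.maxOracle F lo) lo}) rd) :
    p ∈ relevantArms F w Ms ∧ gap F w Ms p ≤ 6 * rd p := by
  have hF : F.Nonempty := ⟨Ms, hMs.1⟩
  set M := O.maxOracle F lo with hMdef
  set B := O.bottleneckSearch M lo with hBdef
  set c := O.argmin M lo with hcdef
  set D := B.filter (fun e => (1 / 2) * (minW M lo + lo e) < up e) ∪ {c} with hDdef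
  have hM : M ∈ F := O.maxOracle_mem F lo subset_rfl hF
  have hmax := O.maxOracle_max F lo subset_rfl hF
  have hcM : c ∈ M := O.argmin_mem M lo (hne M hM)
  have hc : lo c = minW M lo := O.apply_argmin (hne M hM) lo
  have hMw : minW M lo ≤ minW M w := minW_mono (hne M hM) fun e _ => hlo e
  have hcD : c ∈ D := by simp [hDdef]
  have hD : D.Nonempty := ⟨c, hcD⟩
  have hle : ∀ e ∈ D, rd e ≤ rd p := fun e he => hp ▸ O.le_argmax D rd hD e he
  have hviol : ∀ e ∈ B, (1 / 2) * (minW M lo + lo e) < up e → rd e ≤ rd p := fun e he h =>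
    hle e (Finset.mem_union_left _ (Finset.mem_filter.2 ⟨he, h⟩))
  have hpD : p ∈ D := hp ▸ O.argmax_mem D rd hD
  -- the optimal value exceeds the largest lower confidence bound of a bottleneck value by at most
  -- two radii
  have hopt : minW Ms w ≤ minW M lo + 2 * rd p := by
    by_cases hsub : M ⊆ Ms
    · have hMMs := hMs.eq_of_subset hM (hne M hM) hsub
      have h1 := minW_le w hcM
      rw [hMMs] at h1 hc
      rw [hMMs]
      linarith [hup c, hrd c, hle c hcD]
    · obtain ⟨e, heB, heMs, he⟩ :=
        O.bottleneckSearch_complete M hM lo Ms (mem_nonSupersets.2 ⟨hMs.1, hsub⟩)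
      have h1 := minW_le w heMs
      have h2 := hmax Ms hMs.1
      by_cases hv : (1 / 2) * (minW M lo + lo e) < up e
      · linarith [hviol e heB hv, hup e, hrd e]
      · exact absurd (hMs.eq_of_le hM (by linarith [hup e])) fun h => hsub h.subset
  rw [hDdef, Finset.mem_union, Finset.mem_filter, Finset.mem_singleton] at hpD
  have hupp := hup p
  rw [hrd p] at hupp
  have hlop := hlo p
  rcases hpD with ⟨hpB, hpv⟩ | hpc
  · obtain ⟨M', hM', hpM', hpe⟩ := O.bottleneckSearch_sound M hM lo p hpB
    obtain ⟨hM'F, hM'sub⟩ := mem_nonSupersets.1 hM'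
    have hM'w : minW M' lo ≤ minW M' w := minW_mono (hne M' hM'F) fun e _ => hlo e
    have hM'max := hmax M' hM'F
    rw [hrd p] at hpv
    refine ⟨mem_relevantArms hM'F hpM', ?_⟩
    by_cases hpMs : p ∈ Ms
    · by_cases hM'Ms : M' = Ms
      · have hMne : M ≠ Ms := fun h => hM'sub (h.trans hM'Ms.symm).subset
        linarith [gap_le_of_mem (w := w) hpMs hM hMne]
      · linarith [gap_le_of_mem (w := w) hpMs hM'F hM'Ms]
    · rcases lt_or_ge (w p) (minW Ms w) with h | h
      · linarith [gap_le_of_lt hpMs h hM'F hpM']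
      · linarith [gap_le_of_le hpMs h hM'F hpM']
  · have hpM : p ∈ M := hpc ▸ hcM
    rw [← hpc] at hc
    refine ⟨mem_relevantArms hM hpM, ?_⟩
    by_cases hpMs : p ∈ Ms
    · by_cases hMMs : M = Ms
      · push Not at hgo
        obtain ⟨e, heB, he⟩ := hgo
        obtain ⟨M', hM', heM', hee⟩ := O.bottleneckSearch_sound M hM lo e heB
        obtain ⟨hM'F, hM'sub⟩ := mem_nonSupersets.1 hM'
        have hM'w : minW M' lo ≤ minW M' w := minW_mono (hne M' hM'F) fun e _ => hlo e
        have hM'Ms : M' ≠ Ms := fun h => hM'sub (hMMs.trans h.symm).subset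
        linarith [gap_le_of_mem (w := w) hpMs hM'F hM'Ms, hviol e heB he, hrd e]
      · linarith [gap_le_of_mem (w := w) hpMs hM hMMs]
    · rcases lt_or_ge (w p) (minW Ms w) with h | h
      · linarith [gap_le_of_lt hpMs h hM hpM]
      · linarith [gap_le_of_le hpMs h hM hpM]

/-- If the verification stops while its confidence bounds are valid, its answer is correct. -/
lemma verify_halt_correct (hne : ∀ M ∈ F, M.Nonempty) (hMs : IsUniqueOptimal F w Ms)
    (O : Subroutines F) (hM : M ∈ F) (hlo : ∀ e, lo e ≤ w e) (hup : ∀ e, w e ≤ up e)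
    (hhalt : nonSupersets F M = ∅ ∨
      minW (O.maxOracle (nonSupersets F M) up) up ≤ minW M lo) : M = Ms := by
  by_cases hsub : M ⊆ Ms
  · exact hMs.eq_of_subset hM (hne M hM) hsub
  · have hmem := mem_nonSupersets.2 ⟨hMs.1, hsub⟩
    have hG : (nonSupersets F M).Nonempty := ⟨Ms, hmem⟩
    have h1 := hhalt.resolve_left hG.ne_empty
    have hsubF : nonSupersets F M ⊆ F := Finset.filter_subset _ _
    have h2 := O.maxOracle_max _ up hsubF hG Ms hmem
    have h3 : minW Ms w ≤ minW Ms up := minW_mono (hne Ms hMs.1) fun e _ => hup e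
    have h4 : minW M lo ≤ minW M w := minW_mono (hne M hM) fun e _ => hlo e
    exact hMs.eq_of_le hM (by linarith)

/-- If the verification of the optimal super arm continues while its confidence bounds are valid,
it plays an optimal or a necessary base arm, whose gap is at most eight times the confidence
radius. -/
lemma verify_play_gap_le (hne : ∀ M ∈ F, M.Nonempty) (hMs : IsUniqueOptimal F w Ms)
    (O : Subroutines F) (hB : Separating F w Ms B) (hlo : ∀ e, lo e ≤ w e)
    (hup : ∀ e, w e ≤ up e) (hrd : ∀ e, up e = lo e + 2 * rd e)
    (hgo : ¬ (nonSupersets F Ms = ∅ ∨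
      minW (O.maxOracle (nonSupersets F Ms) up) up ≤ minW Ms lo))
    {p : Fin n}
    (hp : p = O.argmax (B.filter (fun e => lo (O.argmin Ms lo) < up e) ∪ {O.argmin Ms lo}) rd) :
    p ∈ Ms ∪ necessaryArms F w Ms ∧ gap F w Ms p ≤ 8 * rd p := by
  set c := O.argmin Ms lo with hcdef
  set D := B.filter (fun e => lo c < up e) ∪ {c} with hDdef
  have hcMs : c ∈ Ms := O.argmin_mem Ms lo (hne Ms hMs.1)
  have hc : lo c = minW Ms lo := O.apply_argmin (hne Ms hMs.1) lo
  have hcw : minW Ms w ≤ w c := minW_le w hcMs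
  have hcD : c ∈ D := by simp [hDdef]
  have hD : D.Nonempty := ⟨c, hcD⟩
  have hle : ∀ e ∈ D, rd e ≤ rd p := fun e he => hp ▸ O.le_argmax D rd hD e he
  have hpD : p ∈ D := hp ▸ O.argmax_mem D rd hD
  -- a base arm of `B` in contention has a mean within four radii of that of `c`
  have hclose : ∀ e ∈ B, lo c < up e → w c - w e ≤ 4 * rd p := by
    intro e he h
    have := hle e (Finset.mem_union_left _ (Finset.mem_filter.2 ⟨he, h⟩))
    linarith [hle c hcD, hup c, hrd c, hrd e, hlo e]
  rw [hDdef, Finset.mem_union, Finset.mem_filter, Finset.mem_singleton] at hpD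
  rcases hpD with ⟨hpB, hpv⟩ | hpc
  · obtain ⟨M', hM', hpM', hpe⟩ := hB.2 p hpB
    obtain ⟨hM'F, hM'sub⟩ := mem_nonSupersets.1 hM'
    have hM'Ms : M' ≠ Ms := fun h => hM'sub h.symm.subset
    have hlt := hMs.2 M' hM'F hM'Ms
    have hpw : w p < minW Ms w := by linarith
    have hpMs : p ∉ Ms := fun h => absurd (minW_le w h) (not_le.2 hpw)
    exact ⟨mem_union_necessaryArms hM'F hpM' hpw,
      by linarith [gap_le_of_lt hpMs hpw hM'F hpM', hclose p hpB hpv]⟩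
  · push Not at hgo
    have hsub : nonSupersets F Ms ⊆ F := Finset.filter_subset _ _
    have hmem := O.maxOracle_mem _ up hsub hgo.1
    obtain ⟨e, heB, heM', he⟩ := hB.1 _ hmem
    have hlt : lo c < up e := by linarith [minW_le up heM', hgo.2]
    obtain ⟨hM'F, hM'sub⟩ := mem_nonSupersets.1 hmem
    have hM'Ms : O.maxOracle (nonSupersets F Ms) up ≠ Ms := fun h => hM'sub h.symm.subset
    have hpMs : p ∈ Ms := hpc ▸ hcMs
    refine ⟨Finset.mem_union_left _ hpMs, ?_⟩
    have h1 := gap_le_of_mem (w := w) hpMs hM'F hM'Ms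
    have h2 := hclose e heB hlt
    rw [hpc] at h1 ⊢
    rw [hpc] at h2
    linarith

end Round

/-! ### Confidence bounds of a phase -/

section Confidence

variable {n : ℕ} {R : ℝ≥0} {δ : ℝ} {w : Fin n → ℝ} {x : Fin n → ℕ → ℝ} {T : Fin n → ℕ}

/-- The logarithmic factor `ln(4 n t³ / δ)` of the squared confidence radius at timestep `t`. -/
noncomputable def confLog (n : ℕ) (δ : ℝ) (t : ℕ) : ℝ := Real.log (4 * (n : ℝ) * (t : ℝ) ^ 3 / δ)

lemma confLog_mono (hn : 0 < n) (hδ : 0 < δ) {s t : ℕ} (hs : 0 < s) (h : s ≤ t) :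
    confLog n δ s ≤ confLog n δ t := by
  unfold confLog
  have hn' : (0 : ℝ) < n := by exact_mod_cast hn
  have hs' : (0 : ℝ) < s := by exact_mod_cast hs
  have h' : (s : ℝ) ≤ t := by exact_mod_cast h
  gcongr

lemma confLog_nonneg (hn : 0 < n) (hδ : 0 < δ) (hδ1 : δ ≤ 1) (t : ℕ) : 0 ≤ confLog n δ t := by
  unfold confLog
  rcases Nat.eq_zero_or_pos t with rfl | ht
  · simp
  · have hn' : (1 : ℝ) ≤ n := by exact_mod_cast hn
    have ht' : (1 : ℝ) ≤ t := by exact_mod_cast ht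
    apply Real.log_nonneg
    rw [le_div_iff₀ hδ]
    nlinarith [one_le_pow₀ ht' (n := 3)]

/-- The reward table `x` is accurate at confidence `δ`: after `s` plays of a base arm, its empirical
mean deviates from its mean by at most the confidence radius at timestep `s + 1`, the earliest at
which these `s` plays can have been made. -/
def Accurate (R : ℝ≥0) (δ : ℝ) (w : Fin n → ℝ) (x : Fin n → ℕ → ℝ) : Prop :=
  ∀ e, ∀ s : ℕ, 0 < s → |(∑ i ∈ Finset.range s, x e i) / (s : ℝ) - w e| ≤
    (R : ℝ) * Real.sqrt (2 * confLog n δ (s + 1) / (s : ℝ))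

lemma Accurate.abs_empMean_sub_le (hx : Accurate R δ w x) (hδ : 0 < δ) {e : Fin n}
    (hT : 0 < T e) : |empMean x T e - w e| ≤ rad R δ T e := by
  refine (hx e (T e) hT).trans ?_
  have hle : T e ≤ ∑ e, T e := Finset.single_le_sum (fun _ _ => Nat.zero_le _) (Finset.mem_univ e)
  have := confLog_mono (n := n) e.pos hδ (Nat.succ_pos (T e)) (Nat.succ_le_succ hle)
  change _ ≤ (R : ℝ) * Real.sqrt (2 * confLog n δ (timestep T) / (T e : ℝ))
  unfold timestep
  gcongr

lemma Accurate.lcb_le (hx : Accurate R δ w x) (hδ : 0 < δ) {e : Fin n} (hT : 0 < T e) :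
    lcb R δ x T e ≤ w e := by
  have := abs_le.1 (hx.abs_empMean_sub_le hδ hT)
  unfold lcb
  linarith

lemma Accurate.le_ucb (hx : Accurate R δ w x) (hδ : 0 < δ) {e : Fin n} (hT : 0 < T e) :
    w e ≤ ucb R δ x T e := by
  have := abs_le.1 (hx.abs_empMean_sub_le hδ hT)
  unfold ucb
  linarith

lemma ucb_eq_lcb_add (e : Fin n) : ucb R δ x T e = lcb R δ x T e + 2 * rad R δ T e := by
  unfold ucb lcb
  ring

/-- A base arm whose confidence radius is not small compared with `g` has been played few times. -/
lemma plays_le_of_le_rad (hδ : 0 < δ) (hδ1 : δ ≤ 1) {e : Fin n} {g a : ℝ} (hg : 0 < g)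
    (h : g ≤ a * rad R δ T e) :
    (T e : ℝ) ≤ 2 * a ^ 2 * ((R : ℝ) ^ 2 / g ^ 2) * confLog n δ (timestep T) := by
  have hL := confLog_nonneg (n := n) e.pos hδ hδ1 (timestep T)
  rcases Nat.eq_zero_or_pos (T e) with h0 | hT
  · rw [h0, Nat.cast_zero]
    positivity
  have hT' : (0 : ℝ) < T e := by exact_mod_cast hT
  have hsq : g ^ 2 ≤ (a * rad R δ T e) ^ 2 := by gcongr
  have hrad : rad R δ T e ^ 2 = (R : ℝ) ^ 2 * (2 * confLog n δ (timestep T) / T e) := by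
    change ((R : ℝ) * Real.sqrt (2 * confLog n δ (timestep T) / (T e : ℝ))) ^ 2 = _
    rw [mul_pow, Real.sq_sqrt (by positivity)]
  rw [mul_pow, hrad] at hsq
  have : g ^ 2 * T e ≤ a ^ 2 * ((R : ℝ) ^ 2 * (2 * confLog n δ (timestep T))) := by
    calc g ^ 2 * T e
        ≤ a ^ 2 * ((R : ℝ) ^ 2 * (2 * confLog n δ (timestep T) / T e)) * T e := by gcongr
      _ = _ := by field_simp
  calc (T e : ℝ) = g ^ 2 * T e / g ^ 2 := by field_simp
    _ ≤ a ^ 2 * ((R : ℝ) ^ 2 * (2 * confLog n δ (timestep T))) / g ^ 2 := by gcongr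
    _ = _ := by ring

end Confidence

/-! ### Decisions of the two phases on accurate rewards -/

section Decisions

variable {n : ℕ} {F : Finset (Finset (Fin n))} {M M' B Ms : Finset (Fin n)} {R : ℝ≥0} {δ : ℝ}
  {w : Fin n → ℝ} {x : Fin n → ℕ → ℝ} {T : Fin n → ℕ}

lemma pos_of_unplayed_eq_empty (h : ¬ (unplayed T).Nonempty) (e : Fin n) : 0 < T e := by
  by_contra h0
  exact h ⟨e, by simp [unplayed]; omega⟩

lemma exploreDecision_halt (hne : ∀ M ∈ F, M.Nonempty) (hMs : IsUniqueOptimal F w Ms)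
    (O : Subroutines F) (hδ : 0 < δ) (hx : Accurate R δ w x)
    (h : exploreDecision O R δ x T = .halt (M, B)) : M = Ms ∧ Separating F w Ms B := by
  unfold exploreDecision at h
  dsimp only at h
  split_ifs at h with h1 h2
  have hT := pos_of_unplayed_eq_empty h1
  obtain ⟨hM, hB⟩ := explore_halt_correct hne hMs O (fun e => hx.lcb_le hδ (hT e))
    (fun e => hx.le_ucb hδ (hT e)) h2
  simp only [Decision.halt.injEq, Prod.mk.injEq] at h
  obtain ⟨rfl, rfl⟩ := h
  exact ⟨hM, by rwa [hM]⟩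

lemma exploreDecision_halt_mem (hF : F.Nonempty) (O : Subroutines F)
    (h : exploreDecision O R δ x T = .halt (M, B)) : M ∈ F := by
  unfold exploreDecision at h
  dsimp only at h
  split_ifs at h with h1 h2
  simp only [Decision.halt.injEq, Prod.mk.injEq] at h
  exact h.1 ▸ O.maxOracle_mem F _ subset_rfl hF

/-- The coefficient `b R² / Δ_e²` in the bound on the number of plays of a base arm `e ∈ A`. -/
noncomputable def playCoeff (F : Finset (Finset (Fin n))) (w : Fin n → ℝ) (Ms : Finset (Fin n))
    (R : ℝ≥0) (b : ℝ) (A : Finset (Fin n)) (e : Fin n) : ℝ :=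
  if e ∈ A then b * ((R : ℝ) ^ 2 / gap F w Ms e ^ 2) else 0

lemma exploreDecision_play (hne : ∀ M ∈ F, M.Nonempty) (hcard : 2 ≤ F.card)
    (hMs : IsUniqueOptimal F w Ms) (O : Subroutines F) (hδ : 0 < δ) (hδ1 : δ ≤ 1)
    (hx : Accurate R δ w x) {p : Fin n} (h : exploreDecision O R δ x T = .play p) :
    T p = 0 ∨ (T p : ℝ) ≤
      playCoeff F w Ms R 72 (relevantArms F w Ms) p * confLog n δ (timestep T) := by
  unfold exploreDecision at h
  dsimp only at h
  split_ifs at h with h1 h2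
  · rw [Decision.play.injEq] at h
    have := Finset.min'_mem _ h1
    rw [h] at this
    exact .inl (by simpa [unplayed] using this)
  · right
    have hT := pos_of_unplayed_eq_empty h1
    rw [Decision.play.injEq] at h
    obtain ⟨hp, hgap⟩ := explore_play_gap_le hne hMs O (fun e => hx.lcb_le hδ (hT e))
      (fun e => hx.le_ucb hδ (hT e)) ucb_eq_lcb_add h2 h.symm
    rw [playCoeff, if_pos hp]
    convert plays_le_of_le_rad hδ hδ1 (gap_pos hcard hMs hp) hgap using 3
    norm_num

lemma verifyDecision_halt (hne : ∀ M ∈ F, M.Nonempty) (hMs : IsUniqueOptimal F w Ms)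
    (O : Subroutines F) (hδ : 0 < δ) (hx : Accurate R δ w x) (hM : M ∈ F)
    (h : verifyDecision O R δ M B x T = .halt M') : M' = Ms := by
  unfold verifyDecision at h
  dsimp only at h
  split_ifs at h with h1 h2
  have hT := pos_of_unplayed_eq_empty h1
  rw [Decision.halt.injEq] at h
  exact h ▸ verify_halt_correct hne hMs O hM (fun e => hx.lcb_le hδ (hT e))
    (fun e => hx.le_ucb hδ (hT e)) h2

lemma verifyDecision_play (hne : ∀ M ∈ F, M.Nonempty) (hcard : 2 ≤ F.card)
    (hMs : IsUniqueOptimal F w Ms) (O : Subroutines F) (hδ : 0 < δ) (hδ1 : δ ≤ 1)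
    (hx : Accurate R δ w x) (hB : Separating F w Ms B) {p : Fin n}
    (h : verifyDecision O R δ Ms B x T = .play p) :
    T p = 0 ∨ (T p : ℝ) ≤
      playCoeff F w Ms R 128 (Ms ∪ necessaryArms F w Ms) p * confLog n δ (timestep T) := by
  unfold verifyDecision at h
  dsimp only at h
  split_ifs at h with h1 h2
  · rw [Decision.play.injEq] at h
    have := Finset.min'_mem _ h1
    rw [h] at this
    exact .inl (by simpa [unplayed] using this)
  · right
    have hT := pos_of_unplayed_eq_empty h1
    rw [Decision.play.injEq] at h
    obtain ⟨hp, hgap⟩ := verify_play_gap_le hne hMs O hB (fun e => hx.lcb_le hδ (hT e))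
      (fun e => hx.le_ucb hδ (hT e)) ucb_eq_lcb_add h2 h.symm
    rw [playCoeff, if_pos hp]
    convert plays_le_of_le_rad hδ hδ1 (gap_pos hcard hMs (Finset.mem_union_left _ hp)) hgap
      using 3
    norm_num

lemma exploreDecision_zero (hn : 0 < n) (O : Subroutines F) :
    ∃ p, exploreDecision O R δ x 0 = .play p := by
  have h : (unplayed (0 : Fin n → ℕ)).Nonempty := ⟨⟨0, hn⟩, by simp [unplayed]⟩
  exact ⟨_, by rw [exploreDecision, dif_pos h]⟩

lemma verifyDecision_zero (hn : 0 < n) (O : Subroutines F) :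
    ∃ p, verifyDecision O R δ M B x 0 = .play p := by
  have h : (unplayed (0 : Fin n → ℕ)).Nonempty := ⟨⟨0, hn⟩, by simp [unplayed]⟩
  exact ⟨_, by rw [verifyDecision, dif_pos h]⟩

end Decisions

/-! ### The length of a run of `BLUCB-Verify` -/

section Run

variable {n : ℕ} {F : Finset (Finset (Fin n))} {M B Ms : Finset (Fin n)} {R : ℝ≥0} {δ : ℝ}
  {w : Fin n → ℝ} {xE xV : Fin n → ℕ → ℝ} {T : Fin n → ℕ}

/-- No base arm `e` has been played more than `1 + a e * L` times. -/
def PlaysBounded (a : Fin n → ℝ) (L : ℝ) (T : Fin n → ℕ) : Prop := ∀ e, (T e : ℝ) ≤ 1 + a e * L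

lemma PlaysBounded.add_single {a : Fin n → ℝ} {L L' : ℝ} (h : PlaysBounded a L T)
    (ha : ∀ e, 0 ≤ a e) (hL : 0 ≤ L) (hLL : L' ≤ L) {p : Fin n}
    (hp : T p = 0 ∨ (T p : ℝ) ≤ a p * L') : PlaysBounded a L (T + Pi.single p 1) := by
  intro e
  by_cases hep : e = p
  · subst hep
    have h1 := mul_nonneg (ha e) hL
    have h2 := mul_le_mul_of_nonneg_left hLL (ha e)
    simp only [Pi.add_apply, Pi.single_eq_same, Nat.cast_add, Nat.cast_one]
    rcases hp with hp | hp
    · simp [hp, h1]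
    · linarith
  · simpa [Pi.single_eq_of_ne hep] using h e

lemma PlaysBounded.zero {a : Fin n → ℝ} {L : ℝ} (ha : ∀ e, 0 ≤ a e) (hL : 0 ≤ L) :
    PlaysBounded a L 0 := by
  intro e
  have := mul_nonneg (ha e) hL
  simp only [Pi.zero_apply, Nat.cast_zero]
  linarith

lemma PlaysBounded.sum_le {a : Fin n → ℝ} {L : ℝ} (h : PlaysBounded a L T) :
    ((∑ e, T e : ℕ) : ℝ) ≤ n + (∑ e, a e) * L := by
  push_cast
  refine (Finset.sum_le_sum fun e _ => h e).trans ?_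
  simp [Finset.sum_add_distrib, Finset.sum_mul]

lemma playCoeff_nonneg {b : ℝ} (hb : 0 ≤ b) (A : Finset (Fin n)) (e : Fin n) :
    0 ≤ playCoeff F w Ms R b A e := by
  unfold playCoeff
  split_ifs <;> positivity

lemma sum_playCoeff (b : ℝ) (A : Finset (Fin n)) :
    ∑ e, playCoeff F w Ms R b A e = b * hardness F w Ms R A := by
  simp [playCoeff, hardness, Finset.sum_ite_mem, Finset.mul_sum]

lemma sum_add_single (T : Fin n → ℕ) (p : Fin n) :
    ∑ e, (T + Pi.single p 1 : Fin n → ℕ) e = ∑ e, T e + 1 := by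
  simp [Finset.sum_add_distrib]

/-- The state of `BLUCB-Verify` after `j` samples. -/
noncomputable def verifyRun (O : Subroutines F) (R : ℝ≥0) (δ : ℝ) (xE xV : Fin n → ℕ → ℝ) (j : ℕ) :
    VerifyState n :=
  (fun s => (VerifyState.sample O R δ xE xV s).check O R δ xE xV)^[j] (.exploring 0)

lemma verifyRun_succ (O : Subroutines F) (j : ℕ) : verifyRun O R δ xE xV (j + 1) =
    ((verifyRun O R δ xE xV j).sample O R δ xE xV).check O R δ xE xV :=
  Function.iterate_succ_apply' _ _ _

/-- If the rewards of the verification are accurate, a run of `BLUCB-Verify` can only return the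
optimal super arm, whatever happens in the exploration. -/
lemma verifyRun_answer (hne : ∀ M ∈ F, M.Nonempty) (hMs : IsUniqueOptimal F w Ms)
    (O : Subroutines F) (hδ : 0 < δ) (hx : Accurate R δ w xV) {j : ℕ}
    (h : (verifyRun O R δ xE xV j).answer = some M) : M = Ms := by
  have hinv : match verifyRun O R δ xE xV j with
      | .exploring _ => True
      | .verifying M _ _ => M ∈ F
      | .returned M => M = Ms := by
    clear h
    induction j with
    | zero => simp [verifyRun]
    | succ j ih =>
      rw [verifyRun_succ]
      -- the stopping test of each phase preserves the invariant
      have hE : ∀ T, match (VerifyState.exploring T).check O R δ xE xV with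
          | .exploring _ => True
          | .verifying M _ _ => M ∈ F
          | .returned M => M = Ms := by
        intro T
        cases hd : exploreDecision O R kappa xE T with
        | play p => simp only [VerifyState.check, hd]
        | halt a =>
          simp only [VerifyState.check, hd]
          exact exploreDecision_halt_mem ⟨Ms, hMs.1⟩ O hd
      have hV : ∀ M B T, M ∈ F → match (VerifyState.verifying M B T).check O R δ xE xV with
          | .exploring _ => True
          | .verifying M _ _ => M ∈ F
          | .returned M => M = Ms := by
        intro M B T hM
        cases hd : verifyDecision O R δ M B xV T with
        | play p => simpa only [VerifyState.check, hd] using hM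
        | halt M' =>
          simp only [VerifyState.check, hd]
          exact verifyDecision_halt hne hMs O hδ hx hM hd
      cases hs : verifyRun O R δ xE xV j with
      | exploring T =>
        cases hd : exploreDecision O R kappa xE T <;>
          simp only [VerifyState.sample, hd] <;> exact hE _
      | verifying M B T =>
        rw [hs] at ih
        cases hd : verifyDecision O R δ M B xV T <;>
          simp only [VerifyState.sample, hd] <;> exact hV _ _ _ ih
      | returned M =>
        rw [hs] at ih
        exact ih
  cases hs : verifyRun O R δ xE xV j with
  | exploring T => simp [hs, VerifyState.answer] at h
  | verifying M B T => simp [hs, VerifyState.answer] at h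
  | returned M' =>
    rw [hs] at hinv h
    simp only [VerifyState.answer, Option.some.injEq] at h
    exact h ▸ hinv

/-- If the rewards of both phases are accurate, a run of `BLUCB-Verify` returns the optimal super arm
after at most `mE + mV` samples, where `mE` and `mV` exceed the numbers of samples that are
possible in a phase of that length. -/
lemma verifyRun_eq_returned (hne : ∀ M ∈ F, M.Nonempty) (hcard : 2 ≤ F.card) (hn : 0 < n)
    (hMs : IsUniqueOptimal F w Ms) (O : Subroutines F) (hδ : 0 < δ) (hδ1 : δ ≤ 1)
    (hxE : Accurate R kappa w xE) (hxV : Accurate R δ w xV) {mE mV : ℕ}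
    (hmE : n + 72 * hardness F w Ms R (relevantArms F w Ms) * confLog n kappa mE < mE)
    (hmV : n + 128 * hardness F w Ms R (Ms ∪ necessaryArms F w Ms) * confLog n δ mV < mV) :
    verifyRun O R δ xE xV (mE + mV) = .returned Ms := by
  have hκ : 0 < kappa := by norm_num [kappa]
  have hκ1 : kappa ≤ 1 := by norm_num [kappa]
  set aE := playCoeff F w Ms R 72 (relevantArms F w Ms) with haE
  set aV := playCoeff F w Ms R 128 (Ms ∪ necessaryArms F w Ms) with haV
  have haE0 : ∀ e, 0 ≤ aE e := playCoeff_nonneg (by norm_num) _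
  have haV0 : ∀ e, 0 ≤ aV e := playCoeff_nonneg (by norm_num) _
  have hLE := confLog_nonneg hn hκ hκ1 mE
  have hLV := confLog_nonneg hn hδ hδ1 mV
  have hltE : ∀ T, PlaysBounded aE (confLog n kappa mE) T → ∑ e, T e < mE := by
    intro T hT
    have := hT.sum_le
    rw [haE, sum_playCoeff] at this
    exact_mod_cast this.trans_lt hmE
  have hltV : ∀ T, PlaysBounded aV (confLog n δ mV) T → ∑ e, T e < mV := by
    intro T hT
    have := hT.sum_le
    rw [haV, sum_playCoeff] at this
    exact_mod_cast this.trans_lt hmV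
  have hinv : ∀ j, match verifyRun O R δ xE xV j with
      | .exploring T => ∑ e, T e = j ∧ PlaysBounded aE (confLog n kappa mE) T ∧
          ∃ p, exploreDecision O R kappa xE T = .play p
      | .verifying M B T => M = Ms ∧ Separating F w Ms B ∧ j ≤ ∑ e, T e + mE ∧
          PlaysBounded aV (confLog n δ mV) T ∧ ∃ p, verifyDecision O R δ M B xV T = .play p
      | .returned M => M = Ms := by
    intro j
    induction j with
    | zero =>
      exact ⟨by simp, PlaysBounded.zero haE0 hLE, exploreDecision_zero hn O⟩
    | succ j ih =>
      rw [verifyRun_succ]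
      cases hs : verifyRun O R δ xE xV j with
      | exploring T =>
        rw [hs] at ih
        obtain ⟨hsum, hT, p, hp⟩ := ih
        have hlt := hltE T hT
        have hT' : PlaysBounded aE (confLog n kappa mE) (T + Pi.single p 1) :=
          hT.add_single haE0 hLE (confLog_mono hn hκ (Nat.succ_pos _) hlt)
            (exploreDecision_play hne hcard hMs O hκ hκ1 hxE hp)
        have hsum' := sum_add_single T p
        simp only [VerifyState.sample, hp, VerifyState.check]
        cases hd : exploreDecision O R kappa xE (T + Pi.single p 1) with
        | play q => exact ⟨by rw [hsum', hsum], hT', q, hd⟩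
        | halt a =>
          obtain ⟨hM, hB⟩ := exploreDecision_halt hne hMs O hκ hxE (M := a.1) (B := a.2) hd
          exact ⟨hM, hB, by simp; omega, PlaysBounded.zero haV0 hLV, verifyDecision_zero hn O⟩
      | verifying M B T =>
        rw [hs] at ih
        obtain ⟨rfl, hB, hsum, hT, p, hp⟩ := ih
        have hlt := hltV T hT
        have hT' : PlaysBounded aV (confLog n δ mV) (T + Pi.single p 1) :=
          hT.add_single haV0 hLV (confLog_mono hn hδ (Nat.succ_pos _) hlt)
            (verifyDecision_play hne hcard hMs O hδ hδ1 hxV hB hp)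
        have hsum' := sum_add_single T p
        simp only [VerifyState.sample, hp, VerifyState.check]
        cases hd : verifyDecision O R δ M B xV (T + Pi.single p 1) with
        | play q => exact ⟨rfl, hB, by omega, hT', q, hd⟩
        | halt M' => exact verifyDecision_halt hne hMs O hδ hxV hMs.1 hd
      | returned M =>
        rw [hs] at ih
        exact ih
  have hfin := hinv (mE + mV)
  cases hs : verifyRun O R δ xE xV (mE + mV) with
  | exploring T =>
    rw [hs] at hfin
    have := hltE T hfin.2.1
    have := hfin.1
    omega
  | verifying M B T =>
    rw [hs] at hfin
    have := hltV T hfin.2.2.2.1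
    have := hfin.2.2.1
    omega
  | returned M =>
    rw [hs] at hfin
    rw [show M = Ms from hfin]

end Run

/-! ### The parallel composition -/

section Parallel

variable {n : ℕ} {F : Finset (Finset (Fin n))} {M Ms : Finset (Fin n)} {R : ℝ≥0} {δ : ℝ}
  {x : ℕ → Phase → Fin n → ℕ → ℝ} {c : ℕ → ℕ} {s : ParallelState n} {k : ℕ}

/-- The state of the sub-algorithm `BLUCB-Verify_k` after `j` samples. -/
noncomputable def subRun (O : Subroutines F) (R : ℝ≥0) (δ : ℝ) (x : ℕ → Phase → Fin n → ℕ → ℝ)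
    (k j : ℕ) : VerifyState n :=
  verifyRun O R (confidence δ k) (x k .explore) (x k .verify) j

/-- `s` is a possible state of `BLUCB-Parallel` when `c k` is the number of times that
`BLUCB-Verify_k` was due: unless there is an answer, all these calls have taken place without any
of them returning; an answer is the answer of some sub-algorithm. -/
def Consistent (O : Subroutines F) (R : ℝ≥0) (δ : ℝ) (x : ℕ → Phase → Fin n → ℕ → ℝ) (c : ℕ → ℕ)
    (s : ParallelState n) : Prop :=
  (s.out = none → ∀ k, s.sub k = subRun O R δ x k (c k) ∧ (s.sub k).answer = none) ∧
    ∀ M, s.out = some M → ∃ k j, (subRun O R δ x k j).answer = some M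

lemma Consistent.resume {O : Subroutines F} (h : Consistent O R δ x c s) (k : ℕ) :
    Consistent O R δ x (c + Pi.single k 1) (s.resume O R δ x k) := by
  unfold ParallelState.resume
  cases hout : s.out with
  | some M =>
    refine ⟨fun h0 => ?_, h.2⟩
    simp [hout] at h0
  | none =>
    obtain ⟨hsub, hans⟩ := h.1 hout k
    have hnew : ((s.sub k).sample O R (confidence δ k) (x k .explore) (x k .verify)).check O R
        (confidence δ k) (x k .explore) (x k .verify) = subRun O R δ x k (c k + 1) := by
      rw [hsub, subRun, subRun, verifyRun_succ]
    refine ⟨fun h0 k' => ?_, fun M hM => ⟨k, c k + 1, ?_⟩⟩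
    · by_cases hk : k' = k
      · subst hk
        simp only [Function.update_self, Pi.add_apply, Pi.single_eq_same]
        exact ⟨hnew, h0⟩
      · simpa [Function.update_of_ne hk, Pi.single_eq_of_ne hk] using h.1 hout k'
    · rw [← hnew]
      exact hM

lemma Consistent.foldl {O : Subroutines F} (l : List ℕ) :
    ∀ {c : ℕ → ℕ} {s : ParallelState n}, Consistent O R δ x c s →
      Consistent O R δ x (c + fun k => l.count k) (l.foldl (ParallelState.resume O R δ x) s) := by
  induction l with
  | nil =>
    intro c s h
    simp only [List.count_nil]
    exact h
  | cons k l ih =>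
    intro c s h
    have := ih (h.resume k)
    rw [List.foldl_cons]
    convert this using 1
    funext k'
    simp only [Pi.add_apply, List.count_cons, Pi.single_apply, beq_iff_eq, eq_comm (a := k')]
    omega

/-- The sub-algorithms that are due at timestep `t + 1`. -/
def due (t : ℕ) : List ℕ := (List.range (t + 1)).filter (fun k => 2 ^ k ∣ t + 1)

lemma count_due (t k : ℕ) : (due t).count k = if 2 ^ k ∣ t + 1 then 1 else 0 := by
  have hnd : (due t).Nodup := List.nodup_range.filter _
  rw [hnd.count]
  refine if_congr ?_ rfl rfl
  simp only [due, List.mem_filter, List.mem_range, decide_eq_true_eq, and_iff_right_iff_imp]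
  exact fun h => Nat.lt_two_pow_self.trans_le (Nat.le_of_dvd (Nat.succ_pos t) h)

/-- After timestep `t`, the sub-algorithm `BLUCB-Verify_k` was due `t / 2 ^ k` times. -/
lemma consistent_parallel (O : Subroutines F) (t : ℕ) :
    Consistent O R δ x (fun k => t / 2 ^ k) (parallel O R δ x t) := by
  induction t with
  | zero => exact ⟨fun _ k => by simp [parallel, subRun, verifyRun, VerifyState.answer],
      fun M hM => by simp [parallel] at hM⟩
  | succ t ih =>
    have hc : (fun k => (t + 1) / 2 ^ k) = (fun k => t / 2 ^ k) + fun k => (due t).count k := by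
      funext k
      rw [Pi.add_apply, count_due, Nat.succ_div]
    rw [hc]
    exact ih.foldl (due t)

lemma samples_foldl_le (O : Subroutines F) (l : List ℕ) :
    ∀ s : ParallelState n,
      (l.foldl (ParallelState.resume O R δ x) s).samples ≤ s.samples + l.length := by
  induction l with
  | nil => intro s; simp
  | cons k l ih =>
    intro s
    rw [List.foldl_cons, List.length_cons]
    have : (s.resume O R δ x k).samples ≤ s.samples + 1 := by
      unfold ParallelState.resume
      cases s.out <;> simp
    have := ih (s.resume O R δ x k)
    omega

lemma samples_le_sum (O : Subroutines F) (t : ℕ) :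
    (parallel O R δ x t).samples ≤ ∑ k ∈ Finset.range t, t / 2 ^ k := by
  induction t with
  | zero => simp [parallel]
  | succ t ih =>
    have h1 : (parallel O R δ x (t + 1)).samples ≤ _ := samples_foldl_le O (due t) _
    have h2 : (due t).length = ∑ k ∈ Finset.range (t + 1), if 2 ^ k ∣ t + 1 then 1 else 0 := by
      have hnd : (due t).Nodup := List.nodup_range.filter _
      rw [← Finset.card_filter, ← List.toFinset_card_of_nodup hnd]
      congr 1
      ext k
      simp [due]
    have h3 : ∑ k ∈ Finset.range (t + 1), t / 2 ^ k = ∑ k ∈ Finset.range t, t / 2 ^ k := by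
      rw [Finset.sum_range_succ, Nat.div_eq_of_lt Nat.lt_two_pow_self, add_zero]
    calc (parallel O R δ x (t + 1)).samples
        ≤ ∑ k ∈ Finset.range t, t / 2 ^ k + (due t).length := h1.trans (by omega)
      _ = ∑ k ∈ Finset.range (t + 1), (t + 1) / 2 ^ k := by
        rw [h2, ← h3, ← Finset.sum_add_distrib]
        exact Finset.sum_congr rfl fun k _ => Nat.succ_div.symm

/-- The number of samples in the first `t` timesteps is at most `t + t / 2 + t / 4 + ⋯ ≤ 2 t`. -/
lemma samples_le (O : Subroutines F) (t : ℕ) : (parallel O R δ x t).samples ≤ 2 * t := by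
  refine (samples_le_sum O t).trans ((Nat.geom_sum_le le_rfl t t).trans ?_)
  omega

lemma foldl_resume_of_out {O : Subroutines F} (l : List ℕ) (h : s.out ≠ none) :
    l.foldl (ParallelState.resume O R δ x) s = s := by
  obtain ⟨M, hM⟩ := Option.ne_none_iff_exists'.1 h
  induction l with
  | nil => rfl
  | cons k l ih =>
    rw [List.foldl_cons, show s.resume O R δ x k = s by simp [ParallelState.resume, hM], ih]

lemma parallel_eq_of_out {O : Subroutines F} {t : ℕ} (h : (parallel O R δ x t).out ≠ none)
    {t' : ℕ} (ht : t ≤ t') : parallel O R δ x t' = parallel O R δ x t := by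
  induction t', ht using Nat.le_induction with
  | base => rfl
  | succ t' _ ih =>
    change (due t').foldl _ (parallel O R δ x t') = _
    rw [ih]
    exact foldl_resume_of_out _ h

/-- If `BLUCB-Verify_k` returns after `j` samples, then `BLUCB-Parallel` has an answer after
`2 ^ k * j` timesteps. -/
lemma out_ne_none {O : Subroutines F} {j : ℕ} (h : (subRun O R δ x k j).answer ≠ none) :
    (parallel O R δ x (2 ^ k * j)).out ≠ none := by
  intro hout
  have := (consistent_parallel O (2 ^ k * j)).1 hout k
  rw [this.1] at this
  simp only [Nat.mul_div_cancel_left j (Nat.two_pow_pos k)] at this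
  exact h this.2

lemma sampleComplexity_le {O : Subroutines F} {j : ℕ}
    (h : (subRun O R δ x k j).answer ≠ none) :
    sampleComplexity O R δ x ≤ ((2 * (2 ^ k * j) : ℕ) : ℝ≥0∞) := by
  refine iSup_le fun t => ?_
  norm_cast
  rcases le_total t (2 ^ k * j) with ht | ht
  · exact (samples_le O t).trans (by omega)
  · rw [parallel_eq_of_out (out_ne_none h) ht]
    exact samples_le O _

lemma confidence_pos (hδ : 0 < δ) (k : ℕ) : 0 < confidence δ k := by
  unfold confidence
  positivity

lemma confidence_le (hδ : 0 < δ) (k : ℕ) : confidence δ k ≤ δ / 2 := by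
  unfold confidence
  gcongr
  exact le_self_pow₀ (by norm_num) (by omega)

/-- If the verification rewards of all sub-algorithms are accurate and some sub-algorithm returns,
`BLUCB-Parallel` returns the optimal super arm. -/
lemma returns_of_accurate {w : Fin n → ℝ} (hne : ∀ M ∈ F, M.Nonempty)
    (hMs : IsUniqueOptimal F w Ms) (O : Subroutines F) (hδ : 0 < δ)
    (hx : ∀ k, Accurate R (confidence δ k) w (x k .verify)) {j : ℕ}
    (h : (subRun O R δ x k j).answer ≠ none) : Returns O R δ x Ms := by
  obtain ⟨M, hM⟩ := Option.ne_none_iff_exists'.1 (out_ne_none h)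
  obtain ⟨k', j', hj⟩ := (consistent_parallel O _).2 M hM
  exact ⟨_, by rw [hM, verifyRun_answer hne hMs O (confidence_pos hδ k') (hx k') hj]⟩

end Parallel

/-! ### Concentration of the empirical means -/

section Concentration

variable {n : ℕ} {R : ℝ≥0} {δ : ℝ} {w : Fin n → ℝ} {Ω : Type*}

lemma measurableSet_accurate [MeasurableSpace Ω] {Y : Fin n → ℕ → Ω → ℝ}
    (hY : ∀ e i, Measurable (Y e i)) :
    MeasurableSet {ω | Accurate R δ w (fun e i => Y e i ω)} := by
  simp only [Accurate, Set.ofPred_forall]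
  refine MeasurableSet.iInter fun e => MeasurableSet.iInter fun s =>
    MeasurableSet.iInter fun _ => ?_
  refine measurableSet_le (f := fun ω => |(∑ i ∈ Finset.range s, Y e i ω) / (s : ℝ) - w e|) ?_
    measurable_const
  fun_prop

/-- The two-sided Hoeffding bound for the empirical mean of `s` independent sub-Gaussian rewards,
with the deviation parametrized by the logarithm of the failure probability. -/
lemma measure_deviation_le [MeasurableSpace Ω] {P : Measure Ω} [IsProbabilityMeasure P]
    {Y : ℕ → Ω → ℝ} {v L : ℝ} (hR : 0 < R) (hindep : iIndepFun Y P)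
    (hsub : ∀ i, HasSubgaussianMGF (fun ω => Y i ω - v) (R ^ 2) P) {s : ℕ} (hs : 0 < s)
    (hL : 0 ≤ L) :
    P {ω | (R : ℝ) * Real.sqrt (2 * L / s) < |(∑ i ∈ Finset.range s, Y i ω) / (s : ℝ) - v|} ≤
      ENNReal.ofReal (2 * Real.exp (-L)) := by
  have hs' : (0 : ℝ) < s := by exact_mod_cast hs
  have hR' : (0 : ℝ) < R := by exact_mod_cast hR
  set ε : ℝ := s * (R * Real.sqrt (2 * L / s)) with hε
  have hε0 : 0 ≤ ε := by positivity
  have hexp : -ε ^ 2 / (2 * s * (R ^ 2 : ℝ≥0)) = -L := by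
    have : ε ^ 2 = s ^ 2 * R ^ 2 * (2 * L / s) := by
      rw [hε, mul_pow, mul_pow, Real.sq_sqrt (by positivity)]
      ring
    rw [this]
    push_cast
    field_simp
  have hindep1 : iIndepFun (fun i ω => Y i ω - v) P :=
    hindep.comp (fun _ y => y - v) fun _ => measurable_id.sub_const v
  have hindep2 : iIndepFun (fun i ω => -(Y i ω - v)) P :=
    hindep.comp (fun _ y => -(y - v)) fun _ => (measurable_id.sub_const v).neg
  have h1 := HasSubgaussianMGF.measure_sum_range_ge_le_of_iIndepFun hindep1 (n := s)
    (fun i _ => hsub i) hε0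
  have h2 := HasSubgaussianMGF.measure_sum_range_ge_le_of_iIndepFun hindep2 (n := s)
    (fun i _ => (hsub i).neg) hε0
  rw [hexp] at h1 h2
  have hsubset : {ω | (R : ℝ) * Real.sqrt (2 * L / s) <
        |(∑ i ∈ Finset.range s, Y i ω) / (s : ℝ) - v|} ⊆
      {ω | ε ≤ ∑ i ∈ Finset.range s, (Y i ω - v)} ∪
        {ω | ε ≤ ∑ i ∈ Finset.range s, -(Y i ω - v)} := by
    intro ω hω
    simp only [Set.mem_ofPred_eq, Set.mem_union, Finset.sum_neg_distrib, Finset.sum_sub_distrib,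
      Finset.sum_const, Finset.card_range, nsmul_eq_mul] at hω ⊢
    have heq : ∑ i ∈ Finset.range s, Y i ω - s * v =
        s * ((∑ i ∈ Finset.range s, Y i ω) / (s : ℝ) - v) := by field_simp
    rw [heq, hε, ← mul_neg]
    rcases lt_abs.1 hω with h | h
    · exact .inl (by gcongr)
    · exact .inr (by gcongr)
  calc _ ≤ P ({ω | ε ≤ ∑ i ∈ Finset.range s, (Y i ω - v)} ∪
        {ω | ε ≤ ∑ i ∈ Finset.range s, -(Y i ω - v)}) := measure_mono hsubset
    _ ≤ P {ω | ε ≤ ∑ i ∈ Finset.range s, (Y i ω - v)} +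
        P {ω | ε ≤ ∑ i ∈ Finset.range s, -(Y i ω - v)} := measure_union_le _ _
    _ ≤ ENNReal.ofReal (Real.exp (-L)) + ENNReal.ofReal (Real.exp (-L)) := by
        gcongr
        · rw [← ofReal_measureReal]
          exact ENNReal.ofReal_le_ofReal h1
        · rw [← ofReal_measureReal]
          exact ENNReal.ofReal_le_ofReal h2
    _ = _ := by
        rw [← ENNReal.ofReal_add (Real.exp_nonneg _) (Real.exp_nonneg _), two_mul]

lemma sum_inv_le (N : ℕ) :
    ∑ s ∈ Finset.range N, (1 : ℝ) / (((s : ℝ) + 1) * ((s : ℝ) + 2)) ≤ 1 - 1 / ((N : ℝ) + 1) := by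
  induction N with
  | zero => simp
  | succ N ih =>
    rw [Finset.sum_range_succ]
    refine (add_le_add_left ih _).trans (le_of_eq ?_)
    push_cast
    field_simp
    ring

lemma exp_neg_confLog (hn : 0 < n) (hδ : 0 < δ) {t : ℕ} (ht : 0 < t) :
    Real.exp (-confLog n δ t) = δ / (4 * n * t ^ 3) := by
  have hn' : (0 : ℝ) < n := by exact_mod_cast hn
  have ht' : (0 : ℝ) < t := by exact_mod_cast ht
  rw [confLog, Real.exp_neg, Real.exp_log (by positivity), inv_div]

/-- The rewards of a phase are accurate at confidence `δ` except with probability at most `δ`. -/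
lemma measure_not_accurate_le [MeasurableSpace Ω] {P : Measure Ω} [IsProbabilityMeasure P]
    {Y : Fin n → ℕ → Ω → ℝ} (hR : 0 < R) (hδ : 0 < δ) (hδ1 : δ ≤ 1)
    (hindep : ∀ e, iIndepFun (Y e) P)
    (hsub : ∀ e i, HasSubgaussianMGF (fun ω => Y e i ω - w e) (R ^ 2) P) :
    P {ω | ¬ Accurate R δ w (fun e i => Y e i ω)} ≤ ENNReal.ofReal δ := by
  have hset : {ω | ¬ Accurate R δ w (fun e i => Y e i ω)} ⊆ ⋃ e, ⋃ s : ℕ,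
      {ω | 0 < s ∧ (R : ℝ) * Real.sqrt (2 * confLog n δ (s + 1) / s) <
        |(∑ i ∈ Finset.range s, Y e i ω) / (s : ℝ) - w e|} := by
    intro ω hω
    simp only [Set.mem_ofPred_eq, Accurate, not_forall, not_le, exists_prop] at hω
    simpa using hω
  have hterm : ∀ e : Fin n, ∀ s : ℕ,
      P {ω | 0 < s ∧ (R : ℝ) * Real.sqrt (2 * confLog n δ (s + 1) / s) <
        |(∑ i ∈ Finset.range s, Y e i ω) / (s : ℝ) - w e|} ≤
      ENNReal.ofReal (δ / n * (1 / (((s : ℝ) + 1) * ((s : ℝ) + 2)))) := by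
    intro e s
    have hn : 0 < n := e.pos
    have hn' : (0 : ℝ) < n := by exact_mod_cast hn
    rcases Nat.eq_zero_or_pos s with rfl | hs
    · simp
    · simp only [hs, true_and]
      refine (measure_deviation_le hR (hindep e) (hsub e) hs
        (confLog_nonneg hn hδ hδ1 _)).trans (ENNReal.ofReal_le_ofReal ?_)
      rw [exp_neg_confLog hn hδ (Nat.succ_pos s)]
      push_cast
      have hs' : (1 : ℝ) ≤ s := by exact_mod_cast hs
      have h1 : ((s : ℝ) + 1) * (s + 2) ≤ 2 * (s + 1) ^ 3 := by nlinarith [sq_nonneg (s : ℝ)]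
      calc 2 * (δ / (4 * n * ((s : ℝ) + 1) ^ 3)) = δ / n * (1 / (2 * (s + 1) ^ 3)) := by
            field_simp
            ring
        _ ≤ _ := by gcongr
  have hsum : ∀ e : Fin n, ∑' s : ℕ,
      ENNReal.ofReal (δ / n * (1 / (((s : ℝ) + 1) * ((s : ℝ) + 2)))) ≤ ENNReal.ofReal (δ / n) := by
    intro e
    refine ENNReal.tsum_le_of_sum_range_le fun N => ?_
    rw [← ENNReal.ofReal_sum_of_nonneg fun s _ => by positivity, ← Finset.mul_sum]
    refine ENNReal.ofReal_le_ofReal (mul_le_of_le_one_right (by positivity) ?_)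
    have : (0 : ℝ) ≤ 1 / ((N : ℝ) + 1) := by positivity
    linarith [sum_inv_le N]
  calc _ ≤ _ := measure_mono hset
    _ ≤ ∑ e, P (⋃ s : ℕ, {ω | 0 < s ∧ (R : ℝ) * Real.sqrt (2 * confLog n δ (s + 1) / s) <
        |(∑ i ∈ Finset.range s, Y e i ω) / (s : ℝ) - w e|}) := measure_iUnion_fintype_le _ _
    _ ≤ ∑ e : Fin n, ENNReal.ofReal (δ / n) := Finset.sum_le_sum fun e _ =>
        (measure_iUnion_le _).trans ((ENNReal.tsum_le_tsum (hterm e)).trans (hsum e))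
    _ ≤ ENNReal.ofReal δ := by
        rw [Finset.sum_const, Finset.card_univ, Fintype.card_fin, ← ENNReal.ofReal_nsmul,
          nsmul_eq_mul]
        refine ENNReal.ofReal_le_ofReal ?_
        rcases Nat.eq_zero_or_pos n with rfl | hn
        · simpa using hδ.le
        · have hn' : (0 : ℝ) < n := by exact_mod_cast hn
          exact (mul_div_cancel₀ δ hn'.ne').le

end Concentration

/-! ### Independence of the sub-algorithms -/

section Independence

variable {Ω β : Type*}

/-- If event `G k` depends only on the `k`-th block of an independent family and has probability at
most `p`, then the first `k` of these events occur jointly with probability at most `p ^ k`. -/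
lemma measure_prefix_le [mΩ : MeasurableSpace Ω] {P : Measure Ω} [IsProbabilityMeasure P]
    {m : ℕ × β → MeasurableSpace Ω} (hm : ∀ j, m j ≤ mΩ) (hindep : iIndep m P)
    {G : ℕ → Set Ω} (hG : ∀ k, MeasurableSet[⨆ j ∈ {j : ℕ × β | j.1 = k}, m j] (G k))
    {p : ℝ≥0∞} (hp : ∀ k, P (G k) ≤ p) (k : ℕ) :
    P {ω | ∀ i < k, ω ∈ G i} ≤ p ^ k := by
  induction k with
  | zero => simp
  | succ k ih =>
    have hind : Indep (⨆ j ∈ {j : ℕ × β | j.1 < k}, m j) (⨆ j ∈ {j : ℕ × β | j.1 = k}, m j) P := by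
      refine indep_iSup_of_disjoint hm hindep (Set.disjoint_left.2 fun j h1 h2 => ?_)
      simp only [Set.mem_ofPred_eq] at h1 h2
      omega
    have hmeas : MeasurableSet[⨆ j ∈ {j : ℕ × β | j.1 < k}, m j] {ω | ∀ i < k, ω ∈ G i} := by
      simp only [Set.ofPred_forall]
      refine MeasurableSet.iInter fun i => MeasurableSet.iInter fun hi => ?_
      have hle : (⨆ j ∈ {j : ℕ × β | j.1 = i}, m j) ≤ ⨆ j ∈ {j : ℕ × β | j.1 < k}, m j :=
        biSup_mono fun j hj => by
          simp only [Set.mem_ofPred_eq] at hj ⊢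
          omega
      exact hle _ (hG i)
    have hset : {ω | ∀ i < k + 1, ω ∈ G i} = {ω | ∀ i < k, ω ∈ G i} ∩ G k := by
      ext ω
      exact Nat.forall_lt_succ_right
    rw [hset, (Indep_iff _ _ P).1 hind _ _ hmeas (hG k), pow_succ]
    gcongr
    exact hp k

/-- If the cost is at most `b k` whenever the event `G k` fails, its expectation is at most
`∑ b k * p ^ k`, where `p ^ k` bounds the probability that the first `k` events all occur: charge
`b k` for the first `k` such that `G k` fails. The cost need not be measurable, so the argument
dominates it pointwise. -/
lemma lintegral_le_tsum_prefix [MeasurableSpace Ω] {P : Measure Ω} {G : ℕ → Set Ω}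
    (hGm : ∀ k, MeasurableSet (G k)) {p : ℝ≥0∞}
    (hp : ∀ k, P {ω | ∀ i < k, ω ∈ G i} ≤ p ^ k) {S : Ω → ℝ≥0∞} {b : ℕ → ℝ≥0∞}
    (hb : ∀ k, 1 ≤ b k) (hS : ∀ k, ∀ ω ∉ G k, S ω ≤ b k) :
    ∫⁻ ω, S ω ∂P ≤ ∑' k, b k * p ^ k := by
  have hAm : ∀ k, MeasurableSet {ω | ∀ i < k, ω ∈ G i} := fun k => by
    simp only [Set.ofPred_forall]
    exact MeasurableSet.iInter fun i => MeasurableSet.iInter fun _ => hGm i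
  calc ∫⁻ ω, S ω ∂P
      ≤ ∫⁻ ω, ∑' k, {ω | ∀ i < k, ω ∈ G i}.indicator (fun _ => b k) ω ∂P := by
        refine lintegral_mono fun ω => ?_
        by_cases h : ∃ k, ω ∉ G k
        · classical
          have hmem : ω ∈ {ω | ∀ i < Nat.find h, ω ∈ G i} := fun i hi =>
            not_not.1 (Nat.find_min h hi)
          calc S ω ≤ b (Nat.find h) := hS _ ω (Nat.find_spec h)
            _ = {ω | ∀ i < Nat.find h, ω ∈ G i}.indicator (fun _ => b (Nat.find h)) ω :=
                (Set.indicator_of_mem hmem fun _ => b (Nat.find h)).symm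
            _ ≤ _ := ENNReal.le_tsum (f := fun k =>
                {ω | ∀ i < k, ω ∈ G i}.indicator (fun _ => b k) ω) (Nat.find h)
        · -- where all the events occur, the series of the costs diverges
          push Not at h
          have htop : ∑' k, {ω | ∀ i < k, ω ∈ G i}.indicator (fun _ => b k) ω = ⊤ := by
            rw [eq_top_iff, ← ENNReal.tsum_const_eq_top_of_ne_zero (α := ℕ) one_ne_zero]
            refine ENNReal.tsum_le_tsum fun k => ?_
            rw [Set.indicator_of_mem (show ω ∈ {ω | ∀ i < k, ω ∈ G i} from fun i _ => h i)]
            exact hb k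
          rw [htop]
          exact le_top
    _ = ∑' k, ∫⁻ ω, {ω | ∀ i < k, ω ∈ G i}.indicator (fun _ => b k) ω ∂P :=
        lintegral_tsum fun k => (measurable_const.indicator (hAm k)).aemeasurable
    _ ≤ ∑' k, b k * p ^ k := by
        refine ENNReal.tsum_le_tsum fun k => ?_
        rw [lintegral_indicator_const (hAm k)]
        gcongr
        exact hp k

end Independence

/-! ### Bounds on the length of a run -/

section Calculus

/-- A solution `m` of the self-referential inequality `n + H ln(4 n m³ / δ) < m`, of the order of
`n + H ln(n (H + 1) / δ)`. -/
lemma exists_phase_length {n : ℕ} (hn : 0 < n) {δ H : ℝ} (hδ : 0 < δ) (hδ1 : δ ≤ 1) (hH : 0 ≤ H) :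
    ∃ m : ℕ, 0 < m ∧ n + H * confLog n δ m < m ∧
      (m : ℝ) ≤ 2 * n + 2 * H * Real.log (4 * n / δ) + 6 * H * Real.log (6 * (H + 1)) + 1 := by
  have hn' : (1 : ℝ) ≤ n := by exact_mod_cast hn
  have hl1 : 0 ≤ Real.log (4 * n / δ) := Real.log_nonneg (by rw [le_div_iff₀ hδ]; nlinarith)
  have hl2 : 0 ≤ Real.log (6 * (H + 1)) := Real.log_nonneg (by linarith)
  set X : ℝ := 2 * n + 2 * H * Real.log (4 * n / δ) + 6 * H * Real.log (6 * (H + 1)) with hX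
  have hX0 : 0 ≤ X := by positivity
  refine ⟨⌊X⌋₊ + 1, Nat.succ_pos _, ?_, by push_cast; linarith [Nat.floor_le hX0]⟩
  set m := ⌊X⌋₊ + 1 with hm
  have hm0 : (0 : ℝ) < m := by exact_mod_cast Nat.succ_pos _
  have hXm : X < m := by rw [hm]; push_cast; exact Nat.lt_floor_add_one X
  have hconf : confLog n δ m = Real.log (4 * n / δ) + 3 * Real.log m := by
    rw [confLog, mul_div_right_comm, Real.log_mul (by positivity) (by positivity), Real.log_pow]
    norm_num
  -- the tangent of `ln` at `6 (H + 1)` makes the contribution of `ln m` at most `m / 2`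
  have hlogm : Real.log m ≤ Real.log (6 * (H + 1)) + m / (6 * (H + 1)) := by
    have h1 := Real.log_le_sub_one_of_pos (show (0 : ℝ) < m / (6 * (H + 1)) by positivity)
    rw [Real.log_div (by positivity) (by positivity)] at h1
    linarith
  have hfrac : 3 * H * (m / (6 * (H + 1))) ≤ m / 2 := by
    rw [mul_div_assoc', div_le_div_iff₀ (by positivity) (by norm_num)]
    nlinarith
  have := mul_le_mul_of_nonneg_left hlogm (show 0 ≤ 3 * H by positivity)
  rw [hconf]
  nlinarith

/-- The sample complexity up to a constant factor, with `h` the hardness of the optimal and the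
necessary base arms and `u` the hardness of the unnecessary ones. -/
noncomputable def complexity (N δ h u : ℝ) : ℝ :=
  h * Real.log (N * h / δ) + u * Real.log (N * u)

variable {N δ h u : ℝ}

lemma neg_inv_le_mul_log {a : ℝ} (ha : 0 < a) (hu : 0 ≤ u) : -(1 / a) ≤ u * Real.log (a * u) := by
  rcases hu.eq_or_lt with rfl | hu
  · simpa using ha.le
  · have h1 := Real.one_sub_inv_le_log_of_pos (mul_pos ha hu)
    have h2 := mul_le_mul_of_nonneg_left h1 hu.le
    have h3 : u * (1 - (a * u)⁻¹) = u - 1 / a := by field_simp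
    linarith

lemma add_le_complexity (hN : 2 ≤ N) (hh : 0 ≤ h) (hu : 0 ≤ u) (hδ : 0 < δ) (hδ1 : δ < 0.01)
    (hNhu : N ≤ h + u) : h + u ≤ 4 * complexity N δ h u := by
  unfold complexity
  have e1 := neg_inv_le_mul_log (show 0 < N by linarith) hu
  have e2 := neg_inv_le_mul_log (show 0 < N / δ by positivity) hh
  have e3 : 1 / N ≤ 1 / 2 := by gcongr
  have e4 : 1 / (N / δ) ≤ 0.01 := by
    rw [one_div_div, div_le_iff₀ (by linarith)]
    nlinarith
  rw [div_mul_eq_mul_div] at e2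
  rcases le_total u h with hle | hle
  · have h1 : 1 ≤ h := by linarith
    have : 1 ≤ Real.log (N * h / δ) := by
      rw [Real.le_log_iff_exp_le (by positivity)]
      have : (3 : ℝ) ≤ N * h / δ := by
        rw [le_div_iff₀ hδ]
        nlinarith
      linarith [Real.exp_one_lt_d9]
    nlinarith
  · have h1 : 1 ≤ u := by linarith
    have : 0.6931471803 < Real.log (N * u) := Real.log_two_gt_d9.trans_le
      (Real.log_le_log (by norm_num) (by nlinarith))
    nlinarith

lemma add_mul_log_le_complexity (hN : 2 ≤ N) (hh : 0 ≤ h) (hu : 0 ≤ u) (hδ : 0 < δ)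
    (hδ1 : δ < 0.01) (hNhu : N ≤ h + u) :
    (h + u) * Real.log (N * (h + u + 1)) ≤ 10 * complexity N δ h u := by
  have e0 := add_le_complexity hN hh hu hδ hδ1 hNhu
  unfold complexity at e0 ⊢
  have e1 := neg_inv_le_mul_log (show 0 < N by linarith) hu
  have e2 := neg_inv_le_mul_log (show 0 < N / δ by positivity) hh
  have e3 : 1 / N ≤ 1 / 2 := by gcongr
  have e4 : 1 / (N / δ) ≤ 0.01 := by
    rw [one_div_div, div_le_iff₀ (by linarith)]
    nlinarith
  rw [div_mul_eq_mul_div] at e2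
  have hlog0 : 0 ≤ Real.log (N * (h + u + 1)) := Real.log_nonneg (by nlinarith)
  rcases le_total u h with hle | hle
  · have h1 : 1 ≤ h := by linarith
    have hlog : Real.log (N * (h + u + 1)) ≤ Real.log (N * h / δ) := by
      apply Real.log_le_log (by positivity)
      rw [le_div_iff₀ hδ]
      have : (h + u + 1) * δ ≤ h := by nlinarith
      nlinarith
    have : (h + u) * Real.log (N * (h + u + 1)) ≤ 2 * h * Real.log (N * h / δ) :=
      mul_le_mul (by linarith) hlog hlog0 (by linarith)
    linarith
  · have h1 : 1 ≤ u := by linarith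
    have hNu : 2 ≤ N * u := by nlinarith
    have hlog : Real.log (N * (h + u + 1)) ≤ 3 * Real.log (N * u) := by
      have : Real.log ((N * u) ^ 3) = 3 * Real.log (N * u) := by
        rw [Real.log_pow]
        norm_num
      rw [← this]
      apply Real.log_le_log (by positivity)
      have h2 : N * (h + u + 1) ≤ 3 * (N * u) := by nlinarith
      nlinarith [mul_nonneg (show 0 ≤ N * u by linarith) (sq_nonneg (N * u - 2))]
    have : (h + u) * Real.log (N * (h + u + 1)) ≤ 2 * u * (3 * Real.log (N * u)) :=
      mul_le_mul (by linarith) hlog hlog0 (by linarith)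
    linarith

lemma mul_log_le_complexity (hN : 2 ≤ N) (hh : 0 ≤ h) (hu : 0 ≤ u) (hδ : 0 < δ) (hδ1 : δ < 0.01)
    (hNhu : N ≤ h + u) :
    h * Real.log (N * (h + 1) / δ) ≤ 7 * complexity N δ h u := by
  have e0 := add_le_complexity hN hh hu hδ hδ1 hNhu
  unfold complexity at e0 ⊢
  have e1 := neg_inv_le_mul_log (show 0 < N by linarith) hu
  have e3 : 1 / N ≤ 1 / 2 := by gcongr
  have key : h * Real.log (N * (h + 1) / δ) ≤ h * Real.log (N * h / δ) + 1 := by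
    rcases hh.eq_or_lt with rfl | hh
    · simp
    · have h1 : N * (h + 1) / δ = N * h / δ * ((h + 1) / h) := by field_simp
      have h2 := Real.log_le_sub_one_of_pos (show 0 < (h + 1) / h by positivity)
      rw [h1, Real.log_mul (by positivity) (by positivity), mul_add]
      have h3 := mul_le_mul_of_nonneg_left h2 hh.le
      have h4 : h * ((h + 1) / h - 1) = 1 := by field_simp; ring
      linarith
  linarith

lemma log_mul_le {a b : ℝ} (ha : 0 < a) (hb : 0 < b) : Real.log (a * b) ≤ a + Real.log b := by
  rw [Real.log_mul ha.ne' hb.ne']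
  linarith [Real.log_le_sub_one_of_pos ha]

/-- The lengths of the two phases of `BLUCB-Verify_k`: the exploration does not depend on `k`, and
the verification grows linearly in `k`. -/
lemma exists_run_length {n : ℕ} (hn : 2 ≤ n) (hh : 0 ≤ h) (hu : 0 ≤ u) (hδ : 0 < δ)
    (hδ1 : δ < 0.01) (hnhu : n ≤ h + u) :
    ∃ mE : ℕ, ∃ mV : ℕ → ℕ, 0 < mE ∧ n + 72 * (h + u) * confLog n kappa mE < mE ∧
      ∀ k, n + 128 * h * confLog n (confidence δ k) (mV k) < mV k ∧
        ((mE + mV k : ℕ) : ℝ) ≤ 4000000 * complexity n δ h u * (k + 1) := by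
  have hn0 : 0 < n := by omega
  have hn2 : (2 : ℝ) ≤ n := by exact_mod_cast hn
  have hδk := fun k => confidence_pos hδ k
  have hδk1 : ∀ k, confidence δ k ≤ 1 := fun k => (confidence_le hδ k).trans (by linarith)
  obtain ⟨mE, hmE0, hmE, hmE'⟩ := exists_phase_length hn0 (δ := kappa) (H := 72 * (h + u))
    (by norm_num [kappa]) (by norm_num [kappa]) (by positivity)
  choose mV hmV0 hmV hmV' using fun k => exists_phase_length hn0 (hδk k) (hδk1 k)
    (show 0 ≤ 128 * h by positivity)
  refine ⟨mE, mV, hmE0, hmE, fun k => ⟨hmV k, ?_⟩⟩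
  have c1 := add_le_complexity hn2 hh hu hδ hδ1 hnhu
  have c2 := add_mul_log_le_complexity hn2 hh hu hδ hδ1 hnhu
  have c3 := mul_log_le_complexity hn2 hh hu hδ hδ1 hnhu
  set Φ := complexity n δ h u with hΦ
  -- the exploration
  have hE1 : Real.log (4 * n / kappa) ≤ 400 + Real.log (n * (h + u + 1)) := by
    have : 4 * (n : ℝ) / kappa = 400 * n := by unfold kappa; ring
    rw [this]
    refine (log_mul_le (by norm_num) (by linarith)).trans ?_
    gcongr
    nlinarith
  have hE2 : Real.log (6 * (72 * (h + u) + 1)) ≤ 432 + Real.log (n * (h + u + 1)) := by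
    refine le_trans ?_ (log_mul_le (a := 432) (by norm_num) (by positivity))
    apply Real.log_le_log (by positivity)
    nlinarith
  have hEa := mul_le_mul_of_nonneg_left hE1 (show 0 ≤ 2 * (72 * (h + u)) by positivity)
  have hEb := mul_le_mul_of_nonneg_left hE2 (show 0 ≤ 6 * (72 * (h + u)) by positivity)
  have hEtot : (mE : ℝ) ≤ 1000000 * Φ := by linarith
  -- the verification
  have hV1 : Real.log (4 * n / confidence δ k) ≤ 4 + (k + 1) + Real.log (n * (h + 1) / δ) := by
    have h1 : 4 * (n : ℝ) / confidence δ k = 4 * (2 ^ (k + 1) * (n / δ)) := by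
      unfold confidence
      field_simp
    have h2 : Real.log (2 ^ (k + 1)) ≤ k + 1 := by
      rw [Real.log_pow]
      push_cast
      have := Real.log_two_lt_d9
      have : (0 : ℝ) ≤ k := k.cast_nonneg
      nlinarith
    have h3 : Real.log (n / δ) ≤ Real.log (n * (h + 1) / δ) := by
      apply Real.log_le_log (by positivity)
      gcongr
      nlinarith
    rw [h1]
    refine (log_mul_le (by norm_num) (by positivity)).trans ?_
    rw [Real.log_mul (by positivity) (by positivity)]
    linarith
  have hV2 : Real.log (6 * (128 * h + 1)) ≤ 768 + Real.log (n * (h + 1) / δ) := by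
    refine le_trans ?_ (log_mul_le (a := 768) (by norm_num) (by positivity))
    apply Real.log_le_log (by positivity)
    rw [mul_div_assoc', le_div_iff₀ hδ]
    have : 6 * (128 * h + 1) ≤ 768 * (n * (h + 1)) := by nlinarith
    nlinarith
  have hVa := mul_le_mul_of_nonneg_left hV1 (show 0 ≤ 2 * (128 * h) by positivity)
  have hVb := mul_le_mul_of_nonneg_left hV2 (show 0 ≤ 6 * (128 * h) by positivity)
  have hk : (0 : ℝ) ≤ k := k.cast_nonneg
  have hhk : h * k ≤ 4 * Φ * k := by
    gcongr
    linarith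
  have hΦk : 0 ≤ Φ * k := mul_nonneg (by linarith) hk
  have hmVk := hmV' k
  push_cast
  linarith

end Calculus

/-! ### Failure events of the sub-algorithms -/

section Failure

variable {n : ℕ} {F : Finset (Finset (Fin n))} {Ms : Finset (Fin n)} {R : ℝ≥0} {δ : ℝ}
  {w : Fin n → ℝ} {Ω : Type*}

/-- The event that the rewards of one of the two phases of `BLUCB-Verify_k` are not accurate. -/
def failure (R : ℝ≥0) (δ : ℝ) (w : Fin n → ℝ) (X : ℕ → Phase → Fin n → ℕ → Ω → ℝ) (k : ℕ) :
    Set Ω :=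
  {ω | ¬ (Accurate R kappa w (fun e i => X k .explore e i ω) ∧
    Accurate R (confidence δ k) w (fun e i => X k .verify e i ω))}

lemma measurableSet_failure (m : MeasurableSpace Ω) {X : ℕ → Phase → Fin n → ℕ → Ω → ℝ} {k : ℕ}
    (hX : ∀ ph e i, Measurable (X k ph e i)) : MeasurableSet (failure R δ w X k) :=
  ((measurableSet_accurate (hX .explore)).inter (measurableSet_accurate (hX .verify))).compl

variable [mΩ : MeasurableSpace Ω] {P : Measure Ω}
  {X : ℕ → Phase → Fin n → ℕ → Ω → ℝ}

lemma iIndepFun_arm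
    (hindep : iIndepFun (fun j : ℕ × Phase × Fin n × ℕ => X j.1 j.2.1 j.2.2.1 j.2.2.2) P)
    (k : ℕ) (ph : Phase) (e : Fin n) : iIndepFun (X k ph e) P :=
  hindep.precomp (g := fun i => (k, ph, e, i)) fun i j h => by simpa using h

lemma measure_failure_le [IsProbabilityMeasure P] (hR : 0 < R) (hδ : 0 < δ) (hδ1 : δ < 0.01)
    (hindep : ∀ k ph e, iIndepFun (X k ph e) P)
    (hsub : ∀ k ph e i, HasSubgaussianMGF (fun ω => X k ph e i ω - w e) (R ^ 2) P) (k : ℕ) :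
    P (failure R δ w X k) ≤ ENNReal.ofReal (1 / 8) := by
  have h1 := measure_not_accurate_le (δ := kappa) hR (by norm_num [kappa]) (by norm_num [kappa])
    (hindep k .explore) (hsub k .explore)
  have hle := confidence_le hδ k
  have h2 := measure_not_accurate_le hR (confidence_pos hδ k) (by linarith)
    (hindep k .verify) (hsub k .verify)
  have hset : failure R δ w X k ⊆ {ω | ¬ Accurate R kappa w (fun e i => X k .explore e i ω)} ∪
      {ω | ¬ Accurate R (confidence δ k) w (fun e i => X k .verify e i ω)} :=
    fun ω hω => not_and_or.1 hω
  refine (measure_mono hset).trans ((measure_union_le _ _).trans ((add_le_add h1 h2).trans ?_))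
  rw [← ENNReal.ofReal_add (by norm_num [kappa]) (confidence_pos hδ k).le]
  refine ENNReal.ofReal_le_ofReal ?_
  norm_num [kappa] at hδ1 ⊢
  linarith

/-- The first `k` sub-algorithms all fail with exponentially small probability, because they use
disjoint blocks of the independent rewards. -/
lemma measure_failures_le [IsProbabilityMeasure P] (hR : 0 < R) (hδ : 0 < δ) (hδ1 : δ < 0.01)
    (hmeas : ∀ k ph e i, Measurable (X k ph e i))
    (hindep : iIndepFun (fun j : ℕ × Phase × Fin n × ℕ => X j.1 j.2.1 j.2.2.1 j.2.2.2) P)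
    (hsub : ∀ k ph e i, HasSubgaussianMGF (fun ω => X k ph e i ω - w e) (R ^ 2) P) (k : ℕ) :
    P {ω | ∀ i < k, ω ∈ failure R δ w X i} ≤ ENNReal.ofReal (1 / 8) ^ k := by
  let m : ℕ × Phase × Fin n × ℕ → MeasurableSpace Ω := fun j =>
    MeasurableSpace.comap (X j.1 j.2.1 j.2.2.1 j.2.2.2) inferInstance
  have hG : ∀ k, MeasurableSet[⨆ j ∈ {j : ℕ × Phase × Fin n × ℕ | j.1 = k}, m j]
      (failure R δ w X k) := fun k => by
    refine measurableSet_failure (⨆ j ∈ {j : ℕ × Phase × Fin n × ℕ | j.1 = k}, m j)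
      fun ph e i => ?_
    have hle : m (k, ph, e, i) ≤ ⨆ j ∈ {j | j.1 = k}, m j :=
      le_biSup m (show (k, ph, e, i) ∈ {j : ℕ × Phase × Fin n × ℕ | j.1 = k} from rfl)
    have hX : Measurable[m (k, ph, e, i)] (X k ph e i) := comap_measurable (X k ph e i)
    exact hX.mono hle le_rfl
  have hm : ∀ j, m j ≤ mΩ := fun j => (hmeas _ _ _ _).comap_le
  have hindep' : iIndep m P := hindep
  exact measure_prefix_le hm hindep' hG
    (measure_failure_le hR hδ hδ1 (iIndepFun_arm hindep) hsub) k

lemma tsum_confidence (hδ : 0 < δ) :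
    ∑' k, ENNReal.ofReal (confidence δ k) = ENNReal.ofReal δ := by
  have h : HasSum (confidence δ) δ := by
    have := hasSum_geometric_two' δ
    convert this using 1
    funext k
    rw [confidence, pow_succ]
    field_simp
  rw [← ENNReal.ofReal_tsum_of_nonneg (fun k => (confidence_pos hδ k).le) h.summable, h.tsum_eq]

end Failure

lemma two_le_of_two_le_card {n : ℕ} {F : Finset (Finset (Fin n))} (hne : ∀ M ∈ F, M.Nonempty)
    (hcard : 2 ≤ F.card) : 2 ≤ n := by
  by_contra hn
  have hsub : F ⊆ {Finset.univ} := by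
    intro M hM
    obtain ⟨e, he⟩ := hne M hM
    rw [Finset.mem_singleton]
    ext e'
    have : e' = e := Fin.ext (by omega)
    simp [this, he]
  have := Finset.card_le_card hsub
  rw [Finset.card_singleton] at this
  omega

lemma hardness_relevantArms {n : ℕ} (F : Finset (Finset (Fin n))) (w : Fin n → ℝ)
    (Ms : Finset (Fin n)) (R : ℝ≥0) : hardness F w Ms R (relevantArms F w Ms) =
      hardness F w Ms R (Ms ∪ necessaryArms F w Ms) +
        hardness F w Ms R (unnecessaryArms F w Ms) := by
  refine Finset.sum_union (Finset.disjoint_left.2 fun e h1 h2 => ?_)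
  simp only [necessaryArms, unnecessaryArms, Finset.mem_union, Finset.mem_filter,
    Finset.mem_univ, true_and] at h1 h2
  rcases h1 with h1 | h1
  · exact h2.2.1 h1
  · exact absurd h1.2.2 (not_lt.2 h2.2.2)

lemma hardness_nonneg {n : ℕ} (F : Finset (Finset (Fin n))) (w : Fin n → ℝ)
    (Ms : Finset (Fin n)) (R : ℝ≥0) (A : Finset (Fin n)) : 0 ≤ hardness F w Ms R A :=
  Finset.sum_nonneg fun _ _ => by positivity

end CPEB

open CPEB
theorem theorem2 :
    ∃ C : ℝ, 0 < C ∧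
      ∀ (n : ℕ) (F : Finset (Finset (Fin n))) (_hne : ∀ M ∈ F, M.Nonempty) (_hcard : 2 ≤ F.card)
        -- reward distributions, their means, and sub-Gaussian tails (`R ^ 2` is the variance proxy)
        (ν : Fin n → Measure ℝ) (_hν : ∀ e, IsProbabilityMeasure (ν e))
        (w : Fin n → ℝ) (_hw : ∀ e, w e = ∫ y, y ∂(ν e))
        (R : ℝ≥0) (_hR : 0 < R) (_hsub : ∀ e, HasSubgaussianMGF (fun y => y - w e) (R ^ 2) (ν e))
        -- the unique optimal super arm
        (Ms : Finset (Fin n)) (_hMs : IsUniqueOptimal F w Ms)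
        -- normalization: the total hardness `∑ R² / Δ_e²` is at least the number of base arms
        (_hnorm : (n : ℝ) ≤
          hardness F w Ms R (Ms ∪ necessaryArms F w Ms ∪ unnecessaryArms F w Ms))
        (δ : ℝ) (_hδ0 : 0 < δ) (_hδ1 : δ < 0.01)
        (O : Subroutines F)
        -- independent rewards
        (Ω : Type*) (_ : MeasurableSpace Ω) (P : Measure Ω) (_hP : IsProbabilityMeasure P)
        (X : ℕ → Phase → Fin n → ℕ → Ω → ℝ)
        (_hmeas : ∀ k ph e i, Measurable (X k ph e i))
        (_hlaw : ∀ k ph e i, P.map (X k ph e i) = ν e)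
        (_hindep : iIndepFun
          (fun j : ℕ × Phase × Fin n × ℕ => X j.1 j.2.1 j.2.2.1 j.2.2.2) P),
        -- the probability of not returning the optimal super arm is at most `δ`
        P {ω | ¬ Returns O R δ (fun k ph e i => X k ph e i ω) Ms} ≤ ENNReal.ofReal δ ∧
        -- the expected number of samples
        ∫⁻ ω, sampleComplexity O R δ (fun k ph e i => X k ph e i ω) ∂P ≤
          ENNReal.ofReal (C *
            ((∑ e ∈ Ms ∪ necessaryArms F w Ms, (R : ℝ) ^ 2 / gap F w Ms e ^ 2) *
                Real.log (1 / δ *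
                  ∑ e ∈ Ms ∪ necessaryArms F w Ms, (R : ℝ) ^ 2 * n / gap F w Ms e ^ 2) +
              (∑ e ∈ unnecessaryArms F w Ms, (R : ℝ) ^ 2 / gap F w Ms e ^ 2) *
                Real.log (
                  ∑ e ∈ unnecessaryArms F w Ms, (R : ℝ) ^ 2 * n / gap F w Ms e ^ 2))) := by
  refine ⟨4 * 4000000, by norm_num, ?_⟩
  intro n F hne hcard ν _ w _ R hR hsubν Ms hMs hnorm δ hδ hδ1 O Ω _ P _ X hmeas hlaw hindep
  have hsub : ∀ k ph e i, HasSubgaussianMGF (fun ω => X k ph e i ω - w e) (R ^ 2) P := by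
    intro k ph e i
    refine HasSubgaussianMGF.of_map (hmeas k ph e i).aemeasurable (X := fun y => y - w e) ?_
    rw [hlaw]
    exact hsubν e
  have hn := two_le_of_two_le_card hne hcard
  set h := hardness F w Ms R (Ms ∪ necessaryArms F w Ms) with hh
  set u := hardness F w Ms R (unnecessaryArms F w Ms) with hu
  have hrel : hardness F w Ms R (relevantArms F w Ms) = h + u := hardness_relevantArms F w Ms R
  have hh0 : 0 ≤ h := hardness_nonneg _ _ _ _ _
  have hu0 : 0 ≤ u := hardness_nonneg _ _ _ _ _
  have hnhu : (n : ℝ) ≤ h + u := hrel ▸ hnorm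
  obtain ⟨mE, mV, hmE0, hmE, hmV⟩ := exists_run_length hn hh0 hu0 hδ hδ1 hnhu
  have hprefix := measure_failures_le hR hδ hδ1 hmeas hindep hsub
  -- a sub-algorithm with accurate rewards returns
  have hret : ∀ k, ∀ ω ∉ failure R δ w X k,
      (subRun O R δ (fun k ph e i => X k ph e i ω) k (mE + mV k)).answer ≠ none := by
    intro k ω hω
    obtain ⟨h1, h2⟩ := not_not.1 hω
    have := verifyRun_eq_returned hne hcard (by omega) hMs O (confidence_pos hδ k)
      ((confidence_le hδ k).trans (by linarith)) h1 h2 (by rw [hrel]; exact hmE) (hmV k).1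
    rw [subRun, this]
    simp [VerifyState.answer]
  constructor
  · have hset : {ω | ¬ Returns O R δ (fun k ph e i => X k ph e i ω) Ms} ⊆
        (⋃ k, {ω | ¬ Accurate R (confidence δ k) w (fun e i => X k .verify e i ω)}) ∪
          {ω | ∀ k, ω ∈ failure R δ w X k} := by
      intro ω hω
      by_contra hcon
      simp only [Set.mem_union, Set.mem_iUnion, Set.mem_ofPred_eq, not_or, not_exists, not_not,
        not_forall] at hcon
      obtain ⟨hacc, k, hk⟩ := hcon
      exact hω (returns_of_accurate hne hMs O hδ hacc (hret k ω hk))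
    have hzero : P {ω | ∀ k, ω ∈ failure R δ w X k} = 0 := by
      refine le_antisymm (ge_of_tendsto' (ENNReal.tendsto_pow_atTop_nhds_zero_of_lt_one
        (r := ENNReal.ofReal (1 / 8)) (by rw [ENNReal.ofReal_lt_one]; norm_num)) fun k => ?_)
        zero_le
      have hsubset : {ω | ∀ k, ω ∈ failure R δ w X k} ⊆ {ω | ∀ i < k, ω ∈ failure R δ w X i} :=
        fun ω hω i _ => hω i
      exact (measure_mono hsubset).trans (hprefix k)
    calc _ ≤ _ := measure_mono hset
      _ ≤ _ := measure_union_le _ _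
      _ ≤ ∑' k, ENNReal.ofReal (confidence δ k) + 0 := by
        rw [hzero]
        gcongr
        refine (measure_iUnion_le _).trans (ENNReal.tsum_le_tsum fun k => ?_)
        exact measure_not_accurate_le hR (confidence_pos hδ k)
          ((confidence_le hδ k).trans (by linarith)) (iIndepFun_arm hindep k .verify)
          (hsub k .verify)
      _ = _ := by rw [add_zero, tsum_confidence hδ]
  · have hΦ : (∑ e ∈ Ms ∪ necessaryArms F w Ms, (R : ℝ) ^ 2 / gap F w Ms e ^ 2) *
          Real.log (1 / δ *
            ∑ e ∈ Ms ∪ necessaryArms F w Ms, (R : ℝ) ^ 2 * n / gap F w Ms e ^ 2) +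
        (∑ e ∈ unnecessaryArms F w Ms, (R : ℝ) ^ 2 / gap F w Ms e ^ 2) *
          Real.log (∑ e ∈ unnecessaryArms F w Ms, (R : ℝ) ^ 2 * n / gap F w Ms e ^ 2) =
        complexity n δ h u := by
      have hmul : ∀ A : Finset (Fin n), ∑ e ∈ A, (R : ℝ) ^ 2 * n / gap F w Ms e ^ 2 =
          n * hardness F w Ms R A := fun A => by
        rw [hardness, Finset.mul_sum]
        exact Finset.sum_congr rfl fun e _ => by ring
      rw [hmul, hmul, one_div_mul_eq_div]
      rfl
    rw [hΦ]
    have hΦ0 : 0 ≤ complexity n δ h u := by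
      have := add_le_complexity (by exact_mod_cast hn) hh0 hu0 hδ hδ1 hnhu
      linarith
    set K : ℝ := 4000000 * complexity n δ h u with hK
    have hK0 : 0 ≤ K := by positivity
    refine (lintegral_le_tsum_prefix (fun k => measurableSet_failure _ (hmeas k)) hprefix
      (b := fun k => ((2 * (2 ^ k * (mE + mV k)) : ℕ) : ℝ≥0∞)) (fun k => ?_)
      fun k ω hω => sampleComplexity_le (hret k ω hω)).trans ?_
    · norm_cast
      have : 0 < 2 * (2 ^ k * (mE + mV k)) := by positivity
      omega
    · -- the cost of the `k`-th run is `2 ^ k * (k + 1) ≤ 4 ^ k` up to a constant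
      have hterm : ∀ k, ((2 * (2 ^ k * (mE + mV k)) : ℕ) : ℝ≥0∞) * ENNReal.ofReal (1 / 8) ^ k ≤
          ENNReal.ofReal (2 * K * (1 / 2) ^ k) := by
        intro k
        rw [← ENNReal.ofReal_natCast, ← ENNReal.ofReal_pow (by norm_num),
          ← ENNReal.ofReal_mul (by positivity)]
        refine ENNReal.ofReal_le_ofReal ?_
        have hk : (k : ℝ) + 1 ≤ 2 ^ k := by exact_mod_cast Nat.lt_two_pow_self (n := k)
        have h1 : ((mE + mV k : ℕ) : ℝ) ≤ K * 2 ^ k := (hmV k).2.trans (by gcongr)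
        have h2 : ((1 : ℝ) / 2) ^ k = 2 ^ k * 2 ^ k * (1 / 8) ^ k := by
          rw [← mul_pow, ← mul_pow]
          norm_num
        calc ((2 * (2 ^ k * (mE + mV k)) : ℕ) : ℝ) * (1 / 8) ^ k
            = 2 * (2 ^ k * ((mE + mV k : ℕ) : ℝ)) * (1 / 8) ^ k := by push_cast; ring
          _ ≤ 2 * (2 ^ k * (K * 2 ^ k)) * (1 / 8) ^ k := by gcongr
          _ = _ := by rw [h2]; ring
      have hsum : HasSum (fun k : ℕ => 2 * K * ((1 : ℝ) / 2) ^ k) (2 * K * 2) :=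
        hasSum_geometric_two.mul_left _
      refine (ENNReal.tsum_le_tsum hterm).trans (le_of_eq ?_)
      rw [← ENNReal.ofReal_tsum_of_nonneg (fun k => by positivity) hsum.summable, hsum.tsum_eq, hK]
      congr 1
      ring
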